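/- Let $d,N\ge 1$. An $N$-state uniform pure ensemble in $\mathbb C^d$ is a family $\psi_1,\dots,\psi_N$ of unit vectors with pairwise distinct density operators $|\psi_i\rangle\langle\psi_i|$, each drawn with probability $1/N$. For an integer $k\ge 1$ and two such ensembles $\mathcal E_1=(\psi_i)$, $\mathcal E_2=(\phi_j)$ put $$\bar F^{(k)}(\mathcal E_a,\mathcal E_b)=\mathbb E_{\psi\sim\mathcal E_a,\ \phi\sim\mathcal E_b}\,|\langle\psi|\phi\rangle|^{2k}\quad(\psi,\phi\text{ independent}),$$ $$\mathcal D^{(k)}(\mathcal E_1,\mathcal E_2)=\bar F^{(k)}(\mathcal E_1,\mathcal E_1)+\bar F^{(k)}(\mathcal E_2,\mathcal E_2)-2\bar F^{(k)}(\mathcal E_1,\mathcal E_2).$$ One sample for a pair $(\mathcal E_a,\mathcal E_b)$ is obtained by drawing a state of index $i$ from $\mathcal E_a$ and, independently, a state of index $j$ from $\mathcal E_b$, and performing a SWAP test on the two states; the sample consists of the label $\ell=(i,j)$ and the outcome $R\in\{+1,-1\}$, where $R=+1$ iff the ancilla is measured in $|0\rangle$. In total $M$ independent samples are taken, $M/3$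 for each of the pairs $(1,1),(1,2),(2,2)$ ($M$ a multiple of $3$). For one pair, let $T_\ell$ be the number of samples with label $\ell$; for $T_\ell\ge k$ let $Z_\ell$ be the average, over all $k$-element subsets of the samples with label $\ell$, of the product of their $k$ outcomes $R$. The estimator $\widehat{\bar F^{(k)}}$ of that pair is the average of $Z_\ell$ over all labels with $T_\ell\ge k$ (undefined if there is none), and $\widehat{\mathcal D^{(k)}}$ is the corresponding combination of the three estimators. **Theorem.** Let $k\ge 1$ be a fixed integer and $\delta_0<1$. There is a constant $C>0$, depending only on $k$ and $\delta_0$, such that for all $d$ and $N$, all $N$-state uniform pure ensembles $\mathcal E_1,\mathcal E_2$ in $\mathbb C^d$, all $0<\epsilon\le 2$, all $0<\delta\le\delta_0$, and every $M\in 3\mathbb N$, the following holds. Let $$B_1=\Big(\frac{k!}{\epsilon^2}\log\frac1\delta\Big)^{1/k}N^{2-2/k},\qquad B_2=\max\Big\{\frac{k}{\epsilon^2}\log\frac1\delta,\ N^2\Big(\log\frac{N^2}{\delta}+k\Big)\Big\}.$$ 1. If $N^2\ge\frac{k!}{\epsilon^2}\log\frac1\delta$ and $M\ge C\,B_1$,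 then with probability at least $1-\delta$ the estimator is defined and $|\widehat{\mathcal D^{(k)}}-\mathcal D^{(k)}(\mathcal E_1,\mathcal E_2)|\le\epsilon$. 2. If $N^2\ge\frac{k!}{\epsilon^2}\log\frac1\delta$, the same conclusion holds as soon as $M\ge C\min\{B_1,B_2\}$. 3. Without any condition relating $N$ to $k,\epsilon,\delta$, the same conclusion holds as soon as $M\ge C\,B_2$. -/

import Mathlib

/-- An ensemble of `N` pure states in a `d`-dimensional Hilbert space: a probability distribution
on the indices, and unit vectors whose density operators `|ψ⟩⟨ψ|` are pairwise distinct. -/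
structure PureEnsemble (d N : ℕ) where
  prob : PMF (Fin N)
  state : Fin N → EuclideanSpace ℂ (Fin d)
  norm_state : ∀ x, ‖state x‖ = 1
  distinct : Function.Injective fun x =>
    Matrix.vecMulVec (state x).ofLp (star (state x).ofLp)

/-- All states of the ensemble are equally likely. -/
def PureEnsemble.IsUniform {d N : ℕ} (E : PureEnsemble d N) : Prop :=
  ∀ x, E.prob x = (N : ENNReal)⁻¹

/-- The average `k`-th power fidelity of two ensembles: the expectation of `|⟨ψ|φ⟩|^(2k)` for
independent `ψ` from `E` and `φ` from `F`. -/
noncomputable def avgFidelity {d N : ℕ} (k : ℕ) (E F : PureEnsemble d N) : ℝ :=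
  ∑ i, ∑ j, (E.prob i).toReal * (F.prob j).toReal * ‖inner ℂ (E.state i) (F.state j)‖ ^ (2 * k)

/-- The MMD-`k` pseudo distance. -/
noncomputable def mmd {d N : ℕ} (k : ℕ) (E F : PureEnsemble d N) : ℝ :=
  avgFidelity k E E + avgFidelity k F F - 2 * avgFidelity k E F

/-- Amplitudes of a pure state of one ancilla qubit and two `d`-dimensional systems. -/
abbrev Register (d : ℕ) : Type := Fin 2 → Fin d → Fin d → ℂ

/-- The product state `|0⟩ ⊗ ψ ⊗ φ`. -/
def swapInput {d : ℕ} (ψ φ : EuclideanSpace ℂ (Fin d)) : Register d :=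
  fun a i j => if a = 0 then ψ i * φ j else 0

/-- The Hadamard gate on the ancilla. -/
noncomputable def hadamardAncilla {d : ℕ} (v : Register d) : Register d :=
  fun a i j => ∑ b, (!![1, 1; 1, -1] : Matrix (Fin 2) (Fin 2) ℂ) a b / (√2 : ℝ) * v b i j

/-- The swap of the two systems, controlled by the ancilla. -/
def controlledSwap {d : ℕ} (v : Register d) : Register d :=
  fun a i j => if a = 1 then v a j i else v a i j

/-- The state of the register at the end of the SWAP-test circuit, before the measurement. -/
noncomputable def swapTestState {d : ℕ} (ψ φ : EuclideanSpace ℂ (Fin d)) : Register d :=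
  hadamardAncilla (controlledSwap (hadamardAncilla (swapInput ψ φ)))

/-- The Born probability of finding the ancilla in the computational basis state `a`. -/
noncomputable def ancillaProb {d : ℕ} (v : Register d) (a : Fin 2) : ℝ :=
  ∑ i, ∑ j, ‖v a i j‖ ^ 2

theorem sum_ancillaProb_swapTestState {d : ℕ} (ψ φ : EuclideanSpace ℂ (Fin d))
    (hψ : ‖ψ‖ = 1) (hφ : ‖φ‖ = 1) : ∑ a, ancillaProb (swapTestState ψ φ) a = 1 := by
  have h2 : ((√2 : ℝ) : ℂ) * ((√2 : ℝ) : ℂ) = 2 := by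
    rw [← Complex.ofReal_mul, Real.mul_self_sqrt (by norm_num)]; norm_num
  have h2' : ((√2 : ℝ) : ℂ) ≠ 0 := by
    intro h; rw [h] at h2; norm_num at h2
  have e0 : ∀ i j, swapTestState ψ φ 0 i j = (ψ i * φ j + ψ j * φ i) / 2 := by
    intro i j
    simp [swapTestState, hadamardAncilla, controlledSwap, swapInput]
    field_simp
    linear_combination (-(ψ i * φ j + ψ j * φ i)) * h2
  have e1 : ∀ i j, swapTestState ψ φ 1 i j = (ψ i * φ j - ψ j * φ i) / 2 := by
    intro i j
    simp [swapTestState, hadamardAncilla, controlledSwap, swapInput]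
    field_simp
    linear_combination (-(ψ i * φ j - ψ j * φ i)) * h2
  have hs : ∀ χ : EuclideanSpace ℂ (Fin d), ‖χ‖ = 1 → ∑ i, ‖χ i‖ ^ 2 = 1 := by
    intro χ h
    rw [← EuclideanSpace.norm_sq_eq, h, one_pow]
  have hp : ∀ i j, ‖swapTestState ψ φ 0 i j‖ ^ 2 + ‖swapTestState ψ φ 1 i j‖ ^ 2
      = (‖ψ i‖ ^ 2 * ‖φ j‖ ^ 2 + ‖ψ j‖ ^ 2 * ‖φ i‖ ^ 2) / 2 := by
    intro i j
    rw [e0, e1]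
    have := parallelogram_law_with_norm ℝ (ψ i * φ j) (ψ j * φ i)
    simp only [norm_mul] at this
    simp only [norm_div, Complex.norm_ofNat]
    linear_combination this / 4
  have hc : ∑ i, ∑ j, ‖ψ i‖ ^ 2 * ‖φ j‖ ^ 2 = 1 := by
    rw [← Finset.sum_mul_sum, hs ψ hψ, hs φ hφ, one_mul]
  simp only [Fin.sum_univ_two, ancillaProb, ← Finset.sum_add_distrib, hp]
  simp only [← Finset.sum_div, Finset.sum_add_distrib]
  rw [Finset.sum_comm (f := fun i j => ‖ψ j‖ ^ 2 * ‖φ i‖ ^ 2), hc]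
  norm_num

/-- The law of the measured ancilla value of the SWAP test on two unit vectors. -/
noncomputable def swapTestLaw {d : ℕ} (ψ φ : EuclideanSpace ℂ (Fin d))
    (hψ : ‖ψ‖ = 1) (hφ : ‖φ‖ = 1) : PMF (Fin 2) :=
  PMF.ofFintype (fun a => ENNReal.ofReal (ancillaProb (swapTestState ψ φ) a)) (by
    rw [← ENNReal.ofReal_sum_of_nonneg, sum_ancillaProb_swapTestState ψ φ hψ hφ,
      ENNReal.ofReal_one]
    intro a _
    unfold ancillaProb
    positivity)

/-- One sample: the label `(i, j)` of the two states and the measured ancilla value. -/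
abbrev Sample (N : ℕ) : Type := (Fin N × Fin N) × Fin 2

/-- The value `R = 2Y - 1` of a sample: `+1` if the ancilla is found in `|0⟩`, else `-1`. -/
def Sample.sign {N : ℕ} (x : Sample N) : ℝ := if x.2 = 0 then 1 else -1

/-- The law of one sample: one state from `E` and, independently, one state from `F`, followed by
the SWAP test on these two states. -/
noncomputable def sampleLaw {d N : ℕ} (E F : PureEnsemble d N) : PMF (Sample N) :=
  E.prob.bind fun i => F.prob.bind fun j =>
    (swapTestLaw (E.state i) (F.state j) (E.norm_state i) (F.norm_state j)).map
      fun a => ((i, j), a)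

/-- The law of `s` independent samples. -/
noncomputable def dataLaw {d N : ℕ} (E F : PureEnsemble d N) (s : ℕ) :
    MeasureTheory.Measure (Fin s → Sample N) :=
  MeasureTheory.Measure.pi fun _ => (sampleLaw E F).toMeasure

/-- The positions of the samples with label `ℓ`. -/
def positions {N s : ℕ} (x : Fin s → Sample N) (ℓ : Fin N × Fin N) : Finset (Fin s) :=
  Finset.univ.filter fun t => (x t).1 = ℓ

/-- The labels that occur at least `k` times. -/
def goodLabels {N s : ℕ} (k : ℕ) (x : Fin s → Sample N) : Finset (Fin N × Fin N) :=
  Finset.univ.filter fun ℓ => k ≤ (positions x ℓ).card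

/-- The U-statistic of a label: the average of the products of `k` distinct outcomes. -/
noncomputable def uStat {N s : ℕ} (k : ℕ) (x : Fin s → Sample N) (ℓ : Fin N × Fin N) : ℝ :=
  (1 / ((positions x ℓ).card.choose k : ℝ)) *
    ∑ r ∈ (positions x ℓ).powersetCard k, ∏ t ∈ r, (x t).sign

/-- The estimator of the average `k`-th power fidelity: the average of the U-statistics over the
labels that occur at least `k` times. It is meaningful only if there is such a label. -/
noncomputable def avgFidelityEst {N s : ℕ} (k : ℕ) (x : Fin s → Sample N) : ℝ :=
  (1 / ((goodLabels k x).card : ℝ)) * ∑ ℓ ∈ goodLabels k x, uStat k x ℓ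

/-- The law of the whole experiment: independently, `s` samples for each of the pairs
`(E, E)`, `(F, F)` and `(E, F)`, hence `3 * s` samples in total. -/
noncomputable def experimentLaw {d N : ℕ} (E F : PureEnsemble d N) (s : ℕ) :
    MeasureTheory.Measure
      ((Fin s → Sample N) × (Fin s → Sample N) × (Fin s → Sample N)) :=
  (dataLaw E E s).prod ((dataLaw F F s).prod (dataLaw E F s))

/-- The estimator of MMD-`k`, from the data of the pairs `(E, E)`, `(F, F)` and `(E, F)`. -/
noncomputable def mmdEst {N s : ℕ} (k : ℕ)
    (x : (Fin s → Sample N) × (Fin s → Sample N) × (Fin s → Sample N)) : ℝ :=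
  avgFidelityEst k x.1 + avgFidelityEst k x.2.1 - 2 * avgFidelityEst k x.2.2

/-- The estimator of MMD-`k` is well defined: each of the three averages is over a nonempty set. -/
def mmdEstDefined {N s : ℕ} (k : ℕ)
    (x : (Fin s → Sample N) × (Fin s → Sample N) × (Fin s → Sample N)) : Prop :=
  (goodLabels k x.1).Nonempty ∧ (goodLabels k x.2.1).Nonempty ∧ (goodLabels k x.2.2).Nonempty

/-- With `s` samples for each of the three pairs, the estimator is well defined and within `ε` of
MMD-`k`, except with probability at most `δ`. -/
def EstimatesMMD {d N : ℕ} (k : ℕ) (E F : PureEnsemble d N) (s : ℕ) (ε δ : ℝ) : Prop :=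
  (experimentLaw E F s).real
    {x | ¬ (mmdEstDefined k x ∧ |mmdEst k x - mmd k E F| ≤ ε)} ≤ δ

/-- The quantity `(k! / ε²) log (1 / δ)`. -/
noncomputable def precisionCost (k : ℕ) (ε δ : ℝ) : ℝ :=
  (k.factorial : ℝ) / ε ^ 2 * Real.log (1 / δ)

/-- The bound for large ensembles, `((k! / ε²) log (1 / δ))^(1/k) N^(2 - 2/k)`. -/
noncomputable def largeEnsembleBound (k N : ℕ) (ε δ : ℝ) : ℝ :=
  precisionCost k ε δ ^ (1 / (k : ℝ)) * (N : ℝ) ^ (2 - 2 / (k : ℝ))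

/-- The bound `max {(k / ε²) log (1 / δ), N² (log (N² / δ) + k)}`. -/
noncomputable def allLabelsBound (k N : ℕ) (ε δ : ℝ) : ℝ :=
  max ((k : ℝ) / ε ^ 2 * Real.log (1 / δ))
    ((N : ℝ) ^ 2 * (Real.log ((N : ℝ) ^ 2 / δ) + k))

/-!
Consider one of the three pairs, with `L = N ^ 2` labels and `s` samples. Given the labels, the
outcomes are independent, and the U-statistic of each good label `ℓ` has mean
`a ℓ = |⟨ψ|φ⟩| ^ (2 * k)`; the estimator averages over the good labels only, while the target is
the average of `a` over all labels. If the estimator is undefined or off by more than `η = ε / 4`,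
then the sum of the errors of the U-statistics over the good labels is at least `η` times their
number in absolute value (both vanish if there is no good label), and the exponential Markov
inequality applies to this sum. Its exponential moment is controlled in three steps.

* Given the labels, changing one outcome of a label with `T` samples changes its U-statistic by at
  most `2 k / T`, so McDiarmid's inequality (`piExp_exp_le`) bounds the noise of the outcomes by
  `exp (2 τ² k² ∑ 1 / T)`, see `piExp_exp_sum_uStat_le`.
* The law of the labels is invariant under permutations of the labels, so the set `S` of good
  labels is a sample without replacement. By `sum_perm_exp_le` this sampling contributes a
  factor `exp (τ² / 2 * min |S| (L - |S|))`; the complement enters because the centred values of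
  `a` sum to zero. The key is a comparison with sampling with replacement, `sum_perm_prod_le`,
  which follows from Chebyshev's sum inequality.
* What is left is a decreasing function of the counts of the single labels in product form. The
  counts are negatively associated (`piExp_prod_labelCount_le`), so its expectation is at most the
  product of the expectations, which are binomial tails.

With a bounded number `s / L` of samples per label on average, about `L (s / L) ^ k` labels are
good and each gains a factor `exp (- c η²)` (`estFails_le_of_average_le`). This does not suffice
when `s / L` is large, where the number of good labels saturates at `L`. There the labels with less
than `H` samples are so rare that sampling is negligible, and the outcomes give
`exp (- c H η² L)` for a constant `H` that can be chosen large (`estFails_le_of_le_average`).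
Together these cases give the bound for large ensembles. For the other bound, all labels have at
least `H`, about `s / (4 L)`, samples with high probability; then there is no sampling error, and
the outcomes give `exp (- c η² s)` (`estFails_le_of_all_labels`).

All expectations are finite sums `piExp` over product weights. Constants may depend on `k`, so
McDiarmid's inequality, which loses a factor of order `k` against Hoeffding's inequality for
U-statistics, is good enough.
-/

/-! ### Expectations over finite product spaces -/

/-- The expectation of `F` over independent coordinates `x t`, the `t`-th of which has the
probability vector `w t`. -/
noncomputable def piExp {n : ℕ} {α : Type*} [Fintype α] (w : Fin n → α → ℝ)
    (F : (Fin n → α) → ℝ) : ℝ :=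
  ∑ x, (∏ t, w t (x t)) * F x

section PiExp

variable {n : ℕ} {α : Type*} [Fintype α] {w : Fin n → α → ℝ} {F G : (Fin n → α) → ℝ}

theorem piExp_zero (w : Fin 0 → α → ℝ) (F : (Fin 0 → α) → ℝ) : piExp w F = F Fin.elim0 := by
  simp [piExp, Subsingleton.elim (default : Fin 0 → α) Fin.elim0]

theorem piExp_succ (w : Fin (n + 1) → α → ℝ) (F : (Fin (n + 1) → α) → ℝ) :
    piExp w F = ∑ a, w 0 a * piExp (fun t => w t.succ) fun x => F (Fin.cons a x) := by
  unfold piExp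
  rw [← (Fin.consEquiv fun _ => α).sum_comp, Fintype.sum_prod_type]
  refine Finset.sum_congr rfl fun a _ => ?_
  rw [Finset.mul_sum]
  refine Finset.sum_congr rfl fun x _ => ?_
  rw [Fin.prod_univ_succ]
  simp [Fin.consEquiv, mul_assoc]

theorem piExp_prod (w : Fin n → α → ℝ) (g : Fin n → α → ℝ) :
    piExp w (fun x => ∏ t, g t (x t)) = ∏ t, ∑ a, w t a * g t a := by
  classical
  rw [Finset.prod_univ_sum, Fintype.piFinset_univ]
  simp [piExp, Finset.prod_mul_distrib]

theorem piExp_add : piExp w (fun x => F x + G x) = piExp w F + piExp w G := by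
  simp [piExp, mul_add, Finset.sum_add_distrib]

theorem piExp_const_mul (c : ℝ) : piExp w (fun x => c * F x) = c * piExp w F := by
  simp only [piExp, Finset.mul_sum]
  exact Finset.sum_congr rfl fun x _ => by ring

theorem piExp_sum {ι : Type*} (S : Finset ι) (f : ι → (Fin n → α) → ℝ) :
    piExp w (fun x => ∑ i ∈ S, f i x) = ∑ i ∈ S, piExp w (f i) := by
  simp only [piExp, Finset.mul_sum]
  exact Finset.sum_comm

theorem piExp_const (hw : ∀ t, w t ∈ stdSimplex ℝ α) (c : ℝ) : piExp w (fun _ => c) = c := by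
  have h := piExp_prod w fun _ _ => 1
  simp only [Finset.prod_const_one, mul_one, (hw _).2] at h
  have := piExp_const_mul (w := w) (F := fun _ => 1) c
  simpa [h] using this

theorem piExp_mono (hw : ∀ t, w t ∈ stdSimplex ℝ α) (h : ∀ x, F x ≤ G x) :
    piExp w F ≤ piExp w G :=
  Finset.sum_le_sum fun x _ =>
    mul_le_mul_of_nonneg_left (h x) (Finset.prod_nonneg fun t _ => (hw t).1 _)

theorem piExp_nonneg (hw : ∀ t, w t ∈ stdSimplex ℝ α) (h : ∀ x, 0 ≤ F x) : 0 ≤ piExp w F :=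
  Finset.sum_nonneg fun x _ => mul_nonneg (Finset.prod_nonneg fun t _ => (hw t).1 _) (h x)

end PiExp

/-! ### The bounded differences inequality -/

/-- A form of Hoeffding's lemma: a variable with oscillation at most `c` is subgaussian with
variance proxy `c ^ 2`. -/
theorem sum_mul_exp_le {α : Type*} [Fintype α] {w : α → ℝ} (hw : w ∈ stdSimplex ℝ α)
    {f : α → ℝ} {c : ℝ} (hf : ∀ a b, |f a - f b| ≤ c) (τ : ℝ) :
    ∑ a, w a * Real.exp (τ * f a) ≤ Real.exp (τ * ∑ a, w a * f a + τ ^ 2 / 2 * c ^ 2) := by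
  obtain ⟨h0, h1⟩ := hw
  set m := ∑ a, w a * f a with hm
  have hne : Nonempty α := by
    by_contra h
    rw [not_nonempty_iff] at h
    simp at h1
  have hc : 0 ≤ c := (abs_nonneg _).trans (hf hne.some hne.some)
  have hdev : ∀ a, |f a - m| ≤ c := by
    intro a
    have : f a - m = ∑ b, w b * (f a - f b) := by
      simp only [mul_sub, Finset.sum_sub_distrib, ← Finset.sum_mul, h1, one_mul, hm]
    rw [this]
    refine (Finset.abs_sum_le_sum_abs _ _).trans ?_
    calc ∑ b, |w b * (f a - f b)| ≤ ∑ b, w b * c := Finset.sum_le_sum fun b _ => by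
          rw [abs_mul, abs_of_nonneg (h0 b)]
          exact mul_le_mul_of_nonneg_left (hf a b) (h0 b)
      _ = c := by rw [← Finset.sum_mul, h1, one_mul]
  -- The convex function `exp` lies below its chord over `[-τ c, τ c]`.
  have hchord : ∀ a, Real.exp (τ * (f a - m)) ≤
      Real.cosh (τ * c) + (f a - m) / c * Real.sinh (τ * c) := by
    intro a
    rcases hc.eq_or_lt with hc0 | hc0
    · have : f a - m = 0 := abs_nonpos_iff.1 ((hdev a).trans hc0.symm.le)
      simp [this, ← hc0]
    · have hy := abs_le.1 (hdev a)
      have hy1 : -1 ≤ (f a - m) / c := by rw [le_div_iff₀ hc0]; linarith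
      have hy2 : (f a - m) / c ≤ 1 := by rw [div_le_iff₀ hc0]; linarith
      have := convexOn_exp.2 (Set.mem_univ (τ * c)) (Set.mem_univ (-(τ * c)))
        (show 0 ≤ (1 + (f a - m) / c) / 2 by linarith)
        (show 0 ≤ (1 - (f a - m) / c) / 2 by linarith) (by ring)
      simp only [smul_eq_mul] at this
      have e : (1 + (f a - m) / c) / 2 * (τ * c) + (1 - (f a - m) / c) / 2 * -(τ * c)
          = τ * (f a - m) := by
        field_simp
        ring
      rw [e] at this
      refine this.trans (le_of_eq ?_)
      rw [Real.cosh_eq, Real.sinh_eq]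
      ring
  have hcen : ∑ a, w a * (f a - m) = 0 := by
    simp only [mul_sub, Finset.sum_sub_distrib, ← Finset.sum_mul, h1, one_mul, ← hm, sub_self]
  calc ∑ a, w a * Real.exp (τ * f a)
      = Real.exp (τ * m) * ∑ a, w a * Real.exp (τ * (f a - m)) := by
        rw [Finset.mul_sum]
        refine Finset.sum_congr rfl fun a _ => ?_
        rw [show τ * f a = τ * m + τ * (f a - m) by ring, Real.exp_add]
        ring
    _ ≤ Real.exp (τ * m) *
        ∑ a, w a * (Real.cosh (τ * c) + (f a - m) / c * Real.sinh (τ * c)) := by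
        gcongr with a
        · exact h0 a
        · exact hchord a
    _ = Real.exp (τ * m) * Real.cosh (τ * c) := by
        congr 1
        have : ∀ a, w a * (Real.cosh (τ * c) + (f a - m) / c * Real.sinh (τ * c))
            = w a * Real.cosh (τ * c) + w a * (f a - m) * (Real.sinh (τ * c) / c) :=
          fun a => by ring
        simp only [this, Finset.sum_add_distrib, ← Finset.sum_mul, h1, hcen, one_mul, zero_mul,
          add_zero]
    _ ≤ Real.exp (τ * m) * Real.exp ((τ * c) ^ 2 / 2) := by
        gcongr
        exact Real.cosh_le_exp_half_sq _
    _ = Real.exp (τ * m + τ ^ 2 / 2 * c ^ 2) := by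
        rw [← Real.exp_add]
        ring_nf

/-- McDiarmid's bounded differences inequality for the moment generating function. -/
theorem piExp_exp_le {α : Type*} [Fintype α] :
    ∀ {n : ℕ} {w : Fin n → α → ℝ} {F : (Fin n → α) → ℝ} {c : Fin n → ℝ},
      (∀ t, w t ∈ stdSimplex ℝ α) → (∀ x t a, |F x - F (Function.update x t a)| ≤ c t) →
      ∀ τ : ℝ, piExp w (fun x => Real.exp (τ * F x)) ≤
        Real.exp (τ * piExp w F + τ ^ 2 / 2 * ∑ t, c t ^ 2) := by
  intro n
  induction n with
  | zero => intro w F c hw hF τ; simp [piExp_zero]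
  | succ n ih =>
    intro w F c hw hF τ
    rw [piExp_succ, piExp_succ]
    have hstep : ∀ a, piExp (fun t => w t.succ) (fun x => Real.exp (τ * F (Fin.cons a x))) ≤
        Real.exp (τ * piExp (fun t => w t.succ) (fun x => F (Fin.cons a x)) +
          τ ^ 2 / 2 * ∑ t : Fin n, c t.succ ^ 2) := by
      intro a
      refine ih (F := fun x => F (Fin.cons a x)) (c := fun t => c t.succ) (fun t => hw _) ?_ τ
      intro x t b
      rw [Fin.cons_update]
      exact hF _ _ _
    have hosc : ∀ a b, |piExp (fun t => w t.succ) (fun x => F (Fin.cons a x)) -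
        piExp (fun t => w t.succ) (fun x => F (Fin.cons b x))| ≤ c 0 := by
      intro a b
      have h : ∀ a b, piExp (fun t => w t.succ) (fun x => F (Fin.cons a x)) ≤
          piExp (fun t => w t.succ) (fun x => F (Fin.cons b x)) + c 0 := by
        intro a b
        calc _ ≤ piExp (fun t => w t.succ) (fun x => F (Fin.cons b x) + c 0) := by
              refine piExp_mono (fun t => hw _) fun x => ?_
              have := hF (Fin.cons a x) 0 b
              rw [Fin.update_cons_zero] at this
              linarith [(abs_le.1 this).2]
          _ = _ := by rw [piExp_add, piExp_const fun t => hw _]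
      rw [abs_le]
      constructor <;> linarith [h a b, h b a]
    calc _ ≤ ∑ a, w 0 a * Real.exp (τ * piExp (fun t => w t.succ) (fun x => F (Fin.cons a x)) +
          τ ^ 2 / 2 * ∑ t : Fin n, c t.succ ^ 2) := by
          gcongr with a
          · exact (hw 0).1 a
          · exact hstep a
      _ = (∑ a, w 0 a * Real.exp (τ * piExp (fun t => w t.succ) (fun x => F (Fin.cons a x)))) *
          Real.exp (τ ^ 2 / 2 * ∑ t : Fin n, c t.succ ^ 2) := by
          simp only [Real.exp_add, Finset.sum_mul, mul_assoc]
      _ ≤ _ := by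
          rw [Fin.sum_univ_succ, mul_add, ← add_assoc, Real.exp_add _ (τ ^ 2 / 2 * ∑ t : Fin n, _)]
          gcongr
          exact sum_mul_exp_le (hw 0) hosc τ

/-! ### Negative association of multinomial counts -/

/-- The zero-one principle behind negative association: if `f` is constant off `A` and below that
constant on `A`, and `g` likewise with `A` and its complement exchanged, then `f` and `g` are
negatively correlated. -/
theorem sum_mul_mul_le {α : Type*} [Fintype α] {w : α → ℝ} (hw : w ∈ stdSimplex ℝ α)
    {A : Set α} {f g : α → ℝ} (hf : ∀ a, ∀ b ∉ A, f a ≤ f b) (hg : ∀ a, ∀ b ∈ A, g a ≤ g b) :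
    ∑ a, w a * (f a * g a) ≤ (∑ a, w a * f a) * ∑ a, w a * g a := by
  obtain ⟨h0, h1⟩ := hw
  have hpair : ∀ a b, (f a - f b) * (g a - g b) ≤ 0 := by
    intro a b
    by_cases ha : a ∈ A <;> by_cases hb : b ∈ A
    · rw [(hg a b hb).antisymm (hg b a ha)]; simp
    · exact mul_nonpos_of_nonpos_of_nonneg (sub_nonpos.2 (hf a b hb)) (sub_nonneg.2 (hg b a ha))
    · exact mul_nonpos_of_nonneg_of_nonpos (sub_nonneg.2 (hf b a ha)) (sub_nonpos.2 (hg a b hb))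
    · rw [(hf a b hb).antisymm (hf b a ha)]; simp
  have hsum : ∑ a, ∑ b, w a * w b * ((f a - f b) * (g a - g b)) ≤ 0 :=
    Finset.sum_nonpos fun a _ => Finset.sum_nonpos fun b _ =>
      mul_nonpos_of_nonneg_of_nonpos (mul_nonneg (h0 a) (h0 b)) (hpair a b)
  have hexp : ∑ a, ∑ b, w a * w b * ((f a - f b) * (g a - g b)) =
      2 * (∑ a, w a * (f a * g a) - (∑ a, w a * f a) * ∑ a, w a * g a) := by
    have e : ∀ a b, w a * w b * ((f a - f b) * (g a - g b)) =
        (w a * (f a * g a)) * w b + w a * (w b * (f b * g b)) - (w a * f a) * (w b * g b)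
          - (w a * g a) * (w b * f b) := fun a b => by ring
    simp only [e, Finset.sum_sub_distrib, Finset.sum_add_distrib, ← Finset.mul_sum,
      ← Finset.sum_mul, h1]
    ring
  linarith

/-- Functions of disjoint sets of values of independent coordinates, both monotone in the same
direction, are negatively correlated: `F` increases when a coordinate leaves `A`, and `G` when a
coordinate enters `A`. -/
theorem piExp_mul_le {α : Type*} [Fintype α] {A : Set α} :
    ∀ {n : ℕ} {w : Fin n → α → ℝ} {F G : (Fin n → α) → ℝ}, (∀ t, w t ∈ stdSimplex ℝ α) →
      (∀ x t, ∀ a ∉ A, F x ≤ F (Function.update x t a)) →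
      (∀ x t, ∀ a ∈ A, G x ≤ G (Function.update x t a)) →
      piExp w (fun x => F x * G x) ≤ piExp w F * piExp w G := by
  intro n
  induction n with
  | zero => intro w F G _ _ _; simp [piExp_zero]
  | succ n ih =>
    intro w F G hw hF hG
    simp only [piExp_succ]
    refine le_trans (Finset.sum_le_sum fun a _ => mul_le_mul_of_nonneg_left
      (ih (F := fun x => F (Fin.cons a x)) (G := fun x => G (Fin.cons a x)) (fun t => hw _)
        ?_ ?_) ((hw 0).1 a)) (sum_mul_mul_le (A := A) (hw 0) ?_ ?_)
    · intro x t b hb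
      rw [Fin.cons_update]
      exact hF _ _ _ hb
    · intro x t b hb
      rw [Fin.cons_update]
      exact hG _ _ _ hb
    · intro a b hb
      refine piExp_mono (fun t => hw _) fun x => ?_
      simpa [Fin.update_cons_zero] using hF (Fin.cons a x) 0 b hb
    · intro a b hb
      refine piExp_mono (fun t => hw _) fun x => ?_
      simpa [Fin.update_cons_zero] using hG (Fin.cons a x) 0 b hb

/-- The number of coordinates of `x` equal to `ℓ`. -/
def labelCount {n : ℕ} {Λ : Type*} [DecidableEq Λ] (x : Fin n → Λ) (ℓ : Λ) : ℕ :=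
  (Finset.univ.filter fun t => x t = ℓ).card

theorem labelCount_update_le {n : ℕ} {Λ : Type*} [DecidableEq Λ] (x : Fin n → Λ) (t : Fin n)
    {a ℓ : Λ} (h : a ≠ ℓ) : labelCount (Function.update x t a) ℓ ≤ labelCount x ℓ := by
  refine Finset.card_le_card fun u hu => ?_
  simp only [Finset.mem_filter, Finset.mem_univ, true_and] at hu ⊢
  rcases eq_or_ne u t with rfl | hut
  · simp [h] at hu
  · rwa [Function.update_of_ne hut] at hu

/-- The counts of different labels are negatively associated. -/
theorem piExp_prod_labelCount_le {n : ℕ} {Λ : Type*} [Fintype Λ] [DecidableEq Λ]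
    {w : Fin n → Λ → ℝ} (hw : ∀ t, w t ∈ stdSimplex ℝ Λ) {g : ℕ → ℝ} (hg : Antitone g)
    (hg0 : ∀ m, 0 ≤ g m) (S : Finset Λ) :
    piExp w (fun x => ∏ ℓ ∈ S, g (labelCount x ℓ)) ≤
      ∏ ℓ ∈ S, piExp w fun x => g (labelCount x ℓ) := by
  induction S using Finset.induction_on with
  | empty => simp [piExp_const hw]
  | insert ℓ S hℓ ih =>
    simp only [Finset.prod_insert hℓ]
    refine (piExp_mul_le (A := {ℓ}) hw ?_ ?_).trans
      (mul_le_mul_of_nonneg_left ih (piExp_nonneg hw fun x => hg0 _))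
    · intro x t a ha
      exact hg (labelCount_update_le x t ha)
    · rintro x t a rfl
      refine Finset.prod_le_prod (fun _ _ => hg0 _) fun m hm => hg (labelCount_update_le x t ?_)
      rintro rfl
      exact hℓ hm

/-! ### Symmetrization over relabelings -/

/-- Sampling without replacement is dominated by sampling with replacement: the average over all
permutations of a product over `S` is at most the corresponding power of the mean. -/
theorem sum_perm_prod_le {Λ : Type*} [Fintype Λ] [DecidableEq Λ] {y : Λ → ℝ}
    (hy : ∀ ℓ, 0 ≤ y ℓ) (S : Finset Λ) :
    ∑ σ : Equiv.Perm Λ, ∏ ℓ ∈ S, y (σ ℓ) ≤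
      Fintype.card (Equiv.Perm Λ) * ((∑ ℓ, y ℓ) / Fintype.card Λ) ^ S.card := by
  induction S using Finset.induction_on with
  | empty => simp
  | insert m S hm ih =>
    have hL : (0 : ℝ) < Fintype.card Λ := by
      have : Nonempty Λ := ⟨m⟩
      exact_mod_cast Fintype.card_pos
    -- Group the permutations by the image of `m`.
    set Q : Λ → ℝ := fun ω => ∑ σ : Equiv.Perm Λ with σ m = ω, ∏ ℓ ∈ S, y (σ ℓ) with hQ
    have hfib : ∑ σ : Equiv.Perm Λ, ∏ ℓ ∈ insert m S, y (σ ℓ) = ∑ ω, y ω * Q ω := by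
      rw [← Finset.sum_fiberwise Finset.univ fun σ : Equiv.Perm Λ => σ m]
      refine Finset.sum_congr rfl fun ω _ => ?_
      rw [hQ, Finset.mul_sum]
      refine Finset.sum_congr rfl fun σ hσ => ?_
      rw [Finset.prod_insert hm, (Finset.mem_filter.1 hσ).2]
    have hQsum : ∑ ω, Q ω = ∑ σ : Equiv.Perm Λ, ∏ ℓ ∈ S, y (σ ℓ) :=
      Finset.sum_fiberwise Finset.univ (fun σ : Equiv.Perm Λ => σ m) _
    have hle : ∀ ω ω', y ω ≤ y ω' → Q ω' ≤ Q ω := by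
      intro ω ω' h
      have hre : Q ω = ∑ σ : Equiv.Perm Λ with σ m = ω',
          ∏ ℓ ∈ S, y (Equiv.swap ω ω' (σ ℓ)) := by
        rw [hQ]
        refine Finset.sum_equiv (Equiv.mulLeft (Equiv.swap ω ω')) ?_ ?_
        · intro σ
          simp only [Finset.mem_filter, Finset.mem_univ, true_and, Equiv.coe_mulLeft,
            Equiv.Perm.mul_apply]
          rw [Equiv.swap_apply_eq_iff, Equiv.swap_apply_right]
        · intro σ _
          simp
      rw [hre]
      refine Finset.sum_le_sum fun σ hσ => Finset.prod_le_prod (fun _ _ => hy _) fun ℓ hℓ => ?_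
      have hne : σ ℓ ≠ ω' := by
        rw [← (Finset.mem_filter.1 hσ).2]
        intro e
        exact hm (σ.injective e ▸ hℓ)
      rcases eq_or_ne (σ ℓ) ω with e | e
      · rw [e, Equiv.swap_apply_left]
        exact h
      · rw [Equiv.swap_apply_of_ne_of_ne e hne]
    have hanti : Antivary y Q := fun ω ω' h => by
      by_contra h'
      exact absurd h (not_lt.2 (hle ω ω' (not_le.1 h').le))
    have hcheb := hanti.card_mul_sum_le_sum_mul_sum
    rw [hQsum] at hcheb
    rw [hfib, Finset.card_insert_of_notMem hm, pow_succ]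
    calc ∑ ω, y ω * Q ω ≤
          ((∑ ω, y ω) * ∑ σ : Equiv.Perm Λ, ∏ ℓ ∈ S, y (σ ℓ)) / Fintype.card Λ := by
          rw [le_div_iff₀ hL]
          linarith
      _ = (∑ σ : Equiv.Perm Λ, ∏ ℓ ∈ S, y (σ ℓ)) * ((∑ ω, y ω) / Fintype.card Λ) := by ring
      _ ≤ _ := by
          rw [← mul_assoc]
          exact mul_le_mul_of_nonneg_right ih
            (div_nonneg (Finset.sum_nonneg fun ℓ _ => hy ℓ) hL.le)

theorem labelCount_perm_comp {n : ℕ} {Λ : Type*} [DecidableEq Λ] (σ : Equiv.Perm Λ)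
    (x : Fin n → Λ) (ℓ : Λ) : labelCount (fun t => σ (x t)) ℓ = labelCount x (σ.symm ℓ) := by
  simp only [labelCount, Equiv.eq_symm_apply]

/-- Under a law with uniform coordinates, a function may be averaged over all relabelings. -/
theorem piExp_eq_piExp_average_perm {n : ℕ} {Λ : Type*} [Fintype Λ] [DecidableEq Λ] (u : ℝ)
    (F : (Fin n → Λ) → ℝ) :
    piExp (fun _ _ => u) F = piExp (fun _ _ => u) fun x =>
      (∑ σ : Equiv.Perm Λ, F fun t => σ (x t)) / Fintype.card (Equiv.Perm Λ) := by
  have h : ∀ σ : Equiv.Perm Λ,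
      piExp (fun _ _ => u) (fun x : Fin n → Λ => F fun t => σ (x t)) = piExp (fun _ _ => u) F := by
    intro σ
    unfold piExp
    simp only [Finset.prod_const, ← Finset.mul_sum]
    congr 1
    exact Equiv.sum_comp (Equiv.arrowCongr (Equiv.refl (Fin n)) σ) F
  have hc : (Fintype.card (Equiv.Perm Λ) : ℝ) ≠ 0 := by
    exact_mod_cast Fintype.card_ne_zero
  simp only [div_eq_inv_mul, piExp_const_mul, piExp_sum, h, Finset.sum_const, Finset.card_univ,
    nsmul_eq_mul]
  field_simp

/-- The average over all permutations of the exponential of a centred sum over `S`: both the sum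
over `S` and the opposite sum over the complement of `S` are samples without replacement. -/
theorem sum_perm_exp_le {Λ : Type*} [Fintype Λ] [DecidableEq Λ] [Nonempty Λ] {a : Λ → ℝ}
    (ha0 : ∀ ℓ, 0 ≤ a ℓ) (ha1 : ∀ ℓ, a ℓ ≤ 1) (S : Finset Λ) (τ : ℝ) :
    (∑ σ : Equiv.Perm Λ,
        Real.exp (τ * ∑ ℓ ∈ S, (a (σ ℓ) - (∑ m, a m) / Fintype.card Λ))) /
        Fintype.card (Equiv.Perm Λ) ≤
      Real.exp (τ ^ 2 / 2 * min (S.card : ℝ) (Fintype.card Λ - S.card)) := by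
  have hL : (0 : ℝ) < Fintype.card Λ := by exact_mod_cast Fintype.card_pos
  have hP : (0 : ℝ) < Fintype.card (Equiv.Perm Λ) := by exact_mod_cast Fintype.card_pos
  set m := (∑ m, a m) / Fintype.card Λ with hm
  have hunif : (fun _ : Λ => (Fintype.card Λ : ℝ)⁻¹) ∈ stdSimplex ℝ Λ :=
    ⟨fun _ => (inv_pos.2 hL).le, by simp [hL.ne']⟩
  have key : ∀ (S : Finset Λ) (τ : ℝ),
      ∑ σ : Equiv.Perm Λ, Real.exp (τ * ∑ ℓ ∈ S, (a (σ ℓ) - m)) ≤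
        Fintype.card (Equiv.Perm Λ) * Real.exp (τ ^ 2 / 2 * S.card) := by
    intro S τ
    have hmean : (∑ ℓ, Real.exp (τ * (a ℓ - m))) / Fintype.card Λ ≤ Real.exp (τ ^ 2 / 2) := by
      have := sum_mul_exp_le hunif (f := fun ℓ => a ℓ - m) (c := 1) (fun x y => by
        rw [abs_le]
        constructor <;> linarith [ha0 x, ha0 y, ha1 x, ha1 y]) τ
      rw [← Finset.mul_sum, ← Finset.mul_sum, Finset.sum_sub_distrib, Finset.sum_const,
        Finset.card_univ, nsmul_eq_mul, hm, mul_div_cancel₀ _ hL.ne', sub_self] at this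
      rw [div_eq_inv_mul]
      simpa using this
    calc _ = ∑ σ : Equiv.Perm Λ, ∏ ℓ ∈ S, Real.exp (τ * (a (σ ℓ) - m)) := by
          simp only [Finset.mul_sum, Real.exp_sum]
      _ ≤ _ := sum_perm_prod_le (y := fun ℓ => Real.exp (τ * (a ℓ - m)))
          (fun ℓ => (Real.exp_pos _).le) S
      _ ≤ Fintype.card (Equiv.Perm Λ) * Real.exp (τ ^ 2 / 2) ^ S.card := by
          gcongr
      _ = _ := by rw [← Real.exp_nat_mul]; ring_nf
  rw [div_le_iff₀ hP, mul_comm (Real.exp _)]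
  rcases min_choice (S.card : ℝ) (Fintype.card Λ - S.card) with h | h
  · rw [h]
    exact key S τ
  · rw [h]
    have hcompl : ∀ σ : Equiv.Perm Λ,
        τ * ∑ ℓ ∈ S, (a (σ ℓ) - m) = -τ * ∑ ℓ ∈ Sᶜ, (a (σ ℓ) - m) := by
      intro σ
      have h1 := Finset.sum_add_sum_compl S fun ℓ => a (σ ℓ) - m
      have h2 : ∑ ℓ, (a (σ ℓ) - m) = 0 := by
        rw [Equiv.sum_comp σ fun ℓ => a ℓ - m, Finset.sum_sub_distrib, Finset.sum_const,
          Finset.card_univ, nsmul_eq_mul, hm, mul_div_cancel₀ _ hL.ne', sub_self]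
      linear_combination τ * (h1.trans h2)
    have := key Sᶜ (-τ)
    rw [Finset.card_compl, Nat.cast_sub (Finset.card_le_univ S), neg_sq] at this
    simpa only [hcompl] using this

/-! ### Binomial tails -/

theorem le_one_of_mem_stdSimplex {Λ : Type*} [Fintype Λ] {w : Λ → ℝ} (hw : w ∈ stdSimplex ℝ Λ)
    (ℓ : Λ) : w ℓ ≤ 1 :=
  hw.2 ▸ Finset.single_le_sum (fun a _ => hw.1 a) (Finset.mem_univ ℓ)

section Binomial

variable {Λ : Type*} [DecidableEq Λ]

theorem labelCount_cons {n : ℕ} (a : Λ) (x : Fin n → Λ) (ℓ : Λ) :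
    labelCount (Fin.cons a x : Fin (n + 1) → Λ) ℓ =
      (if a = ℓ then 1 else 0) + labelCount x ℓ := by
  unfold labelCount
  rw [Fin.card_filter_univ_succ]
  split_ifs with h <;> simp_all [add_comm]

theorem labelCount_eq_sum {n : ℕ} (x : Fin n → Λ) (ℓ : Λ) :
    labelCount x ℓ = ∑ t, if x t = ℓ then 1 else 0 := by
  simp [labelCount]

variable [Fintype Λ] {w : Λ → ℝ}

/-- The probability that a binomial variable, the number of occurrences of `ℓ` among `n`
independent labels, is at least `k`. -/
noncomputable def countTail (w : Λ → ℝ) (ℓ : Λ) (n k : ℕ) : ℝ :=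
  piExp (fun _ : Fin n => w) fun x => if k ≤ labelCount x ℓ then 1 else 0

theorem countTail_le_succ (hw : w ∈ stdSimplex ℝ Λ) (ℓ : Λ) (n k : ℕ) :
    countTail w ℓ n k ≤ countTail w ℓ (n + 1) k := by
  unfold countTail
  rw [piExp_succ]
  calc _ = ∑ a, w a * piExp (fun _ : Fin n => w)
        fun x => if k ≤ labelCount x ℓ then (1 : ℝ) else 0 := by
        rw [← Finset.sum_mul, hw.2, one_mul]
    _ ≤ _ := by
        refine Finset.sum_le_sum fun a _ => mul_le_mul_of_nonneg_left
          (piExp_mono (fun _ => hw) fun x => ?_) (hw.1 a)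
        rw [labelCount_cons]
        split_ifs <;> first | omega | norm_num

theorem countTail_mono (hw : w ∈ stdSimplex ℝ Λ) (ℓ : Λ) (k : ℕ) :
    Monotone fun n => countTail w ℓ n k :=
  monotone_nat_of_le_succ fun n => countTail_le_succ hw ℓ n k

theorem countTail_succ_succ (hw : w ∈ stdSimplex ℝ Λ) (ℓ : Λ) (n k : ℕ) :
    countTail w ℓ (n + 1) (k + 1) =
      w ℓ * countTail w ℓ n k + (1 - w ℓ) * countTail w ℓ n (k + 1) := by
  have h : ∀ a, w a * piExp (fun _ : Fin n => w)
      (fun x => if k + 1 ≤ labelCount (Fin.cons a x : Fin (n + 1) → Λ) ℓ then (1 : ℝ) else 0) =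
      w a * countTail w ℓ n (k + 1) +
        if a = ℓ then w ℓ * (countTail w ℓ n k - countTail w ℓ n (k + 1)) else 0 := by
    intro a
    simp only [labelCount_cons]
    split_ifs with ha
    · subst ha
      simp only [countTail, add_comm 1, add_le_add_iff_right]
      ring
    · simp [countTail]
  rw [countTail, piExp_succ]
  simp only [h, Finset.sum_add_distrib, ← Finset.sum_mul, hw.2, Finset.sum_ite_eq',
    Finset.mem_univ, if_true]
  ring

theorem countTail_nonneg (hw : w ∈ stdSimplex ℝ Λ) (ℓ : Λ) (n k : ℕ) :
    0 ≤ countTail w ℓ n k :=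
  piExp_nonneg (fun _ => hw) fun x => by split_ifs <;> norm_num

/-- One more occurrence is found among `b` further labels with probability `1 - (1 - w ℓ) ^ b`. -/
theorem mul_countTail_le (hw : w ∈ stdSimplex ℝ Λ) (ℓ : Λ) (n k b : ℕ) :
    (1 - (1 - w ℓ) ^ b) * countTail w ℓ n k ≤ countTail w ℓ (n + b) (k + 1) := by
  induction b with
  | zero => simpa using countTail_nonneg hw ℓ n (k + 1)
  | succ b ih =>
    rw [← add_assoc, countTail_succ_succ hw, pow_succ]
    have h1 : countTail w ℓ n k ≤ countTail w ℓ (n + b) k :=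
      countTail_mono hw ℓ k (Nat.le_add_right n b)
    have h2 := mul_le_mul_of_nonneg_left ih (sub_nonneg.2 (le_one_of_mem_stdSimplex hw ℓ))
    have h3 := mul_le_mul_of_nonneg_left h1 (hw.1 ℓ)
    linarith

theorem pow_le_countTail (hw : w ∈ stdSimplex ℝ Λ) (ℓ : Λ) {n k b : ℕ} (h : k * b ≤ n) :
    (1 - (1 - w ℓ) ^ b) ^ k ≤ countTail w ℓ n k := by
  refine le_trans ?_ (countTail_mono hw ℓ k h)
  clear h
  induction k with
  | zero => simp [countTail, piExp_const fun _ => hw]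
  | succ k ih =>
    rw [pow_succ', Nat.succ_mul]
    refine (mul_le_mul_of_nonneg_left ih (sub_nonneg.2 (pow_le_one₀ ?_ ?_))).trans
      (mul_countTail_le hw ℓ _ k b)
    · exact sub_nonneg.2 (le_one_of_mem_stdSimplex hw ℓ)
    · linarith [hw.1 ℓ]

/-- Chernoff's bound for the lower tail of a binomial variable. -/
theorem piExp_labelCount_lt_le (hw : w ∈ stdSimplex ℝ Λ) (ℓ : Λ) (n H : ℕ) :
    piExp (fun _ : Fin n => w) (fun x => if labelCount x ℓ < H then 1 else 0) ≤
      Real.exp (H - n * w ℓ / 2) := by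
  have hq := le_one_of_mem_stdSimplex hw ℓ
  have hq0 := hw.1 ℓ
  have he : Real.exp (-1) ≤ 1 / 2 := by
    rw [Real.exp_neg, ← one_div]
    exact one_div_le_one_div_of_le (by norm_num) (by linarith [Real.add_one_le_exp 1])
  calc _ ≤ piExp (fun _ : Fin n => w)
        (fun x => Real.exp H * ∏ t, Real.exp (-(if x t = ℓ then 1 else 0))) := by
        refine piExp_mono (fun _ => hw) fun x => ?_
        rw [← Real.exp_sum, ← Real.exp_add]
        have hc : ∑ t, -(if x t = ℓ then (1 : ℝ) else 0) = -(labelCount x ℓ : ℝ) := by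
          rw [labelCount_eq_sum]
          push_cast
          rw [Finset.sum_neg_distrib]
        rw [hc]
        split_ifs with h
        · apply Real.one_le_exp
          have : (labelCount x ℓ : ℝ) ≤ H := by exact_mod_cast h.le
          linarith
        · exact (Real.exp_pos _).le
    _ = Real.exp H * (∑ a, w a * Real.exp (-(if a = ℓ then 1 else 0))) ^ n := by
        rw [piExp_const_mul, piExp_prod (fun _ : Fin n => w)
          fun _ a => Real.exp (-(if a = ℓ then 1 else 0))]
        simp
    _ = Real.exp H * (1 - w ℓ * (1 - Real.exp (-1))) ^ n := by
        congr 2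
        have h : ∀ a, w a * Real.exp (-(if a = ℓ then 1 else 0)) =
            w a - if a = ℓ then w ℓ * (1 - Real.exp (-1)) else 0 := by
          intro a
          split_ifs with ha
          · subst ha; ring
          · simp
        simp only [h, Finset.sum_sub_distrib, hw.2, Finset.sum_ite_eq', Finset.mem_univ, if_true]
    _ ≤ Real.exp H * Real.exp (-(w ℓ / 2)) ^ n := by
        have h1 : 1 - w ℓ * (1 - Real.exp (-1)) ≤ Real.exp (-(w ℓ / 2)) := by
          have := Real.one_sub_le_exp_neg (w ℓ / 2)
          nlinarith
        have h0 : 0 ≤ 1 - w ℓ * (1 - Real.exp (-1)) := by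
          nlinarith [Real.exp_pos (-1)]
        gcongr
    _ = _ := by
        rw [← Real.exp_nat_mul, ← Real.exp_add]
        ring_nf

end Binomial

/-! ### The U-statistics given the labels -/

section UStat

variable {N s k : ℕ}

/-- The labels that occur at least `k` times among `lam`. -/
def frequentLabels (k : ℕ) (lam : Fin s → Fin N × Fin N) : Finset (Fin N × Fin N) :=
  Finset.univ.filter fun ℓ => k ≤ labelCount lam ℓ

/-- The value `±1` of an ancilla outcome. -/
def outcomeSign (a : Fin 2) : ℝ := if a = 0 then 1 else -1

theorem abs_outcomeSign (a : Fin 2) : |outcomeSign a| = 1 := by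
  unfold outcomeSign
  split_ifs <;> simp

theorem goodLabels_eq (x : Fin s → Sample N) :
    goodLabels k x = frequentLabels k fun t => (x t).1 := rfl

theorem uStat_eq (lam : Fin s → Fin N × Fin N) (a : Fin s → Fin 2) (ℓ : Fin N × Fin N) :
    uStat k (fun t => (lam t, a t)) ℓ = (1 / ((labelCount lam ℓ).choose k : ℝ)) *
      ∑ r ∈ (Finset.univ.filter fun t => lam t = ℓ).powersetCard k,
        ∏ t ∈ r, outcomeSign (a t) := rfl

/-- Given the labels, the U-statistic of a frequent label is unbiased. -/
theorem piExp_uStat {q : Fin N × Fin N → Fin 2 → ℝ} (hq : ∀ ℓ, q ℓ ∈ stdSimplex ℝ (Fin 2))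
    (lam : Fin s → Fin N × Fin N) {ℓ : Fin N × Fin N} (hℓ : k ≤ labelCount lam ℓ) :
    piExp (fun t => q (lam t)) (fun a => uStat k (fun t => (lam t, a t)) ℓ) =
      (∑ a, q ℓ a * outcomeSign a) ^ k := by
  simp only [uStat_eq]
  rw [piExp_const_mul, piExp_sum]
  have h : ∀ r ∈ (Finset.univ.filter fun t => lam t = ℓ).powersetCard k,
      piExp (fun t => q (lam t)) (fun a => ∏ t ∈ r, outcomeSign (a t)) =
        (∑ a, q ℓ a * outcomeSign a) ^ k := by
    intro r hr
    rw [Finset.mem_powersetCard] at hr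
    have e : ∀ a : Fin s → Fin 2, ∏ t ∈ r, outcomeSign (a t) =
        ∏ t, if t ∈ r then outcomeSign (a t) else 1 := by
      intro a
      rw [Finset.prod_ite_mem, Finset.univ_inter]
    simp only [e]
    rw [piExp_prod (fun t => q (lam t)) fun t b => if t ∈ r then outcomeSign b else 1]
    have e2 : ∀ t, (∑ b, q (lam t) b * if t ∈ r then outcomeSign b else 1) =
        if t ∈ r then ∑ b, q ℓ b * outcomeSign b else 1 := by
      intro t
      split_ifs with ht
      · rw [(Finset.mem_filter.1 (hr.1 ht)).2]
      · simpa using (hq (lam t)).2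
    simp only [e2]
    rw [Finset.prod_ite_mem, Finset.univ_inter, Finset.prod_const, hr.2]
  rw [Finset.sum_congr rfl h, Finset.sum_const, Finset.card_powersetCard, nsmul_eq_mul]
  change 1 / ((labelCount lam ℓ).choose k : ℝ) * ((labelCount lam ℓ).choose k * _) = _
  have : ((labelCount lam ℓ).choose k : ℝ) ≠ 0 := by
    exact_mod_cast (Nat.choose_pos hℓ).ne'
  field_simp

/-- A single outcome enters a fraction `k / T` of the products in the U-statistic of its label,
if this label occurs `T` times. -/
theorem abs_uStat_sub_le (hk : 1 ≤ k) (lam : Fin s → Fin N × Fin N) (a : Fin s → Fin 2)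
    (t : Fin s) (b : Fin 2) (hℓ : k ≤ labelCount lam (lam t)) :
    |uStat k (fun u => (lam u, a u)) (lam t) -
        uStat k (fun u => (lam u, Function.update a t b u)) (lam t)| ≤
      2 * k / labelCount lam (lam t) := by
  rw [uStat_eq, uStat_eq, ← mul_sub, ← Finset.sum_sub_distrib, abs_mul]
  set T := labelCount lam (lam t) with hT
  set P := Finset.univ.filter fun u => lam u = lam t with hP
  have hPT : P.card = T := rfl
  have hchoose : (0 : ℝ) < T.choose k := by exact_mod_cast Nat.choose_pos hℓ
  have hT0 : (0 : ℝ) < T := by exact_mod_cast hk.trans hℓ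
  have hterm : ∀ r ∈ P.powersetCard k,
      |∏ u ∈ r, outcomeSign (a u) - ∏ u ∈ r, outcomeSign (Function.update a t b u)| ≤
        if {t} ⊆ r then 2 else 0 := by
    intro r _
    split_ifs with ht
    · refine (abs_sub _ _).trans ?_
      simp only [Finset.abs_prod, abs_outcomeSign, Finset.prod_const_one]
      norm_num
    · rw [Finset.singleton_subset_iff] at ht
      have : ∏ u ∈ r, outcomeSign (Function.update a t b u) = ∏ u ∈ r, outcomeSign (a u) :=
        Finset.prod_congr rfl fun u hu => by
          rw [Function.update_of_ne]
          rintro rfl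
          exact ht hu
      simp [this]
  have hcount : ((P.powersetCard k).filter ({t} ⊆ ·)).card = (T - 1).choose (k - 1) := by
    rw [Finset.card_filter_powersetCard_subset _ _ _ (by simp [hP]) (by simpa using hk), hPT,
      Finset.card_singleton]
  have hid : (T : ℝ) * (T - 1).choose (k - 1) = T.choose k * k := by
    have := Nat.add_one_mul_choose_eq (T - 1) (k - 1)
    rw [Nat.sub_add_cancel (hk.trans hℓ), Nat.sub_add_cancel hk] at this
    exact_mod_cast this
  calc _ ≤ 1 / (T.choose k : ℝ) * ∑ r ∈ P.powersetCard k, if {t} ⊆ r then (2 : ℝ) else 0 := by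
        rw [abs_of_nonneg (by positivity)]
        gcongr
        exact (Finset.abs_sum_le_sum_abs _ _).trans (Finset.sum_le_sum hterm)
    _ = 1 / (T.choose k : ℝ) * ((T - 1).choose (k - 1) * 2) := by
        rw [← Finset.sum_filter, Finset.sum_const, hcount, nsmul_eq_mul]
    _ = 2 * k / T := by
        field_simp
        linear_combination hid

/-- Given the labels, the sum of the U-statistics is subgaussian. -/
theorem piExp_exp_sum_uStat_le (hk : 1 ≤ k) {q : Fin N × Fin N → Fin 2 → ℝ}
    (hq : ∀ ℓ, q ℓ ∈ stdSimplex ℝ (Fin 2)) (lam : Fin s → Fin N × Fin N) (τ : ℝ) :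
    piExp (fun t => q (lam t)) (fun a => Real.exp (τ *
        ∑ ℓ ∈ frequentLabels k lam, uStat k (fun t => (lam t, a t)) ℓ)) ≤
      Real.exp (τ * ∑ ℓ ∈ frequentLabels k lam, (∑ a, q ℓ a * outcomeSign a) ^ k +
        2 * τ ^ 2 * k ^ 2 * ∑ ℓ ∈ frequentLabels k lam, 1 / (labelCount lam ℓ : ℝ)) := by
  set c : Fin s → ℝ := fun t =>
    if lam t ∈ frequentLabels k lam then 2 * k / (labelCount lam (lam t) : ℝ) else 0 with hc
  have hsq : ∑ t, c t ^ 2 =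
      4 * k ^ 2 * ∑ ℓ ∈ frequentLabels k lam, 1 / (labelCount lam ℓ : ℝ) := by
    rw [← Finset.sum_fiberwise Finset.univ lam, Finset.mul_sum,
      ← Finset.sum_subset (Finset.subset_univ (frequentLabels k lam))]
    · refine Finset.sum_congr rfl fun ℓ hℓ => ?_
      have : ∀ t ∈ Finset.univ.filter (fun t => lam t = ℓ),
          c t ^ 2 = (2 * k / (labelCount lam ℓ : ℝ)) ^ 2 := by
        intro t ht
        rw [Finset.mem_filter] at ht
        simp [hc, ht.2, hℓ]
      rw [Finset.sum_congr rfl this, Finset.sum_const, nsmul_eq_mul]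
      change (labelCount lam ℓ : ℝ) * _ = _
      have h0 : (labelCount lam ℓ : ℝ) ≠ 0 := by
        have : k ≤ labelCount lam ℓ := (Finset.mem_filter.1 hℓ).2
        have : 0 < labelCount lam ℓ := by omega
        exact_mod_cast this.ne'
      field_simp
      ring
    · intro ℓ _ hℓ
      refine Finset.sum_eq_zero fun t ht => ?_
      rw [Finset.mem_filter] at ht
      simp [hc, ht.2, hℓ]
  refine (piExp_exp_le (c := c) (fun t => hq _) ?_ τ).trans (le_of_eq ?_)
  · intro a t b
    rw [← Finset.sum_sub_distrib]
    have hother : ∀ ℓ, ℓ ≠ lam t → uStat k (fun u => (lam u, a u)) ℓ -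
        uStat k (fun u => (lam u, Function.update a t b u)) ℓ = 0 := by
      intro ℓ hℓ
      rw [uStat_eq, uStat_eq, sub_eq_zero]
      congr 1
      refine Finset.sum_congr rfl fun r hr => Finset.prod_congr rfl fun u hu => ?_
      rw [Function.update_of_ne]
      rintro rfl
      exact hℓ (Finset.mem_filter.1 ((Finset.mem_powersetCard.1 hr).1 hu)).2.symm
    by_cases ht : lam t ∈ frequentLabels k lam
    · rw [Finset.sum_eq_single_of_mem _ ht fun ℓ _ h => hother ℓ h]
      simp only [hc, ht, if_true]
      exact abs_uStat_sub_le hk lam a t b (Finset.mem_filter.1 ht).2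
    · rw [Finset.sum_eq_zero fun ℓ hℓ => hother ℓ fun e => ht (e ▸ hℓ)]
      simp [hc, ht]
  · have hmean : ∀ ℓ ∈ frequentLabels k lam,
        piExp (fun t => q (lam t)) (fun a => uStat k (fun t => (lam t, a t)) ℓ) =
          (∑ a, q ℓ a * outcomeSign a) ^ k :=
      fun ℓ hℓ => piExp_uStat hq lam (Finset.mem_filter.1 hℓ).2
    rw [piExp_sum, hsq, Finset.sum_congr rfl hmean]
    ring_nf

end UStat

/-! ### The law of the data -/

theorem PureEnsemble.pos {d N : ℕ} (E : PureEnsemble d N) : 0 < N := by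
  obtain ⟨i, _⟩ := E.prob.support_nonempty
  exact i.pos

/-- The probability of an outcome of the SWAP test on the states of a label. -/
noncomputable def outcomeProb {d N : ℕ} (E F : PureEnsemble d N) (ℓ : Fin N × Fin N)
    (a : Fin 2) : ℝ :=
  ancillaProb (swapTestState (E.state ℓ.1) (F.state ℓ.2)) a

/-- The `k`-th power fidelity of the states of a label. -/
noncomputable def labelFidelity {d N : ℕ} (k : ℕ) (E F : PureEnsemble d N)
    (ℓ : Fin N × Fin N) : ℝ :=
  ‖inner ℂ (E.state ℓ.1) (F.state ℓ.2)‖ ^ (2 * k)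

section Data

variable {d N s k : ℕ} {E F : PureEnsemble d N}

theorem ancillaProb_nonneg (v : Register d) (a : Fin 2) : 0 ≤ ancillaProb v a := by
  unfold ancillaProb
  positivity

theorem outcomeProb_mem (E F : PureEnsemble d N) (ℓ : Fin N × Fin N) :
    outcomeProb E F ℓ ∈ stdSimplex ℝ (Fin 2) :=
  ⟨fun _ => ancillaProb_nonneg _ _,
    sum_ancillaProb_swapTestState _ _ (E.norm_state _) (F.norm_state _)⟩

theorem labelFidelity_nonneg (ℓ : Fin N × Fin N) : 0 ≤ labelFidelity k E F ℓ := by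
  unfold labelFidelity
  positivity

theorem labelFidelity_le_one (ℓ : Fin N × Fin N) : labelFidelity k E F ℓ ≤ 1 := by
  refine pow_le_one₀ (norm_nonneg _) ((norm_inner_le_norm _ _).trans ?_)
  rw [E.norm_state, F.norm_state, one_mul]

/-- The outcome `R` of the SWAP test is an unbiased estimate of the fidelity. -/
theorem sum_ancillaProb_mul_outcomeSign (ψ φ : EuclideanSpace ℂ (Fin d)) :
    ∑ a, ancillaProb (swapTestState ψ φ) a * outcomeSign a = ‖inner ℂ ψ φ‖ ^ 2 := by
  have h2 : ((√2 : ℝ) : ℂ) * ((√2 : ℝ) : ℂ) = 2 := by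
    rw [← Complex.ofReal_mul, Real.mul_self_sqrt (by norm_num)]; norm_num
  have h2' : ((√2 : ℝ) : ℂ) ≠ 0 := by
    intro h; rw [h] at h2; norm_num at h2
  have e0 : ∀ i j, swapTestState ψ φ 0 i j = (ψ i * φ j + ψ j * φ i) / 2 := by
    intro i j
    simp [swapTestState, hadamardAncilla, controlledSwap, swapInput]
    field_simp
    linear_combination (-(ψ i * φ j + ψ j * φ i)) * h2
  have e1 : ∀ i j, swapTestState ψ φ 1 i j = (ψ i * φ j - ψ j * φ i) / 2 := by
    intro i j
    simp [swapTestState, hadamardAncilla, controlledSwap, swapInput]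
    field_simp
    linear_combination (-(ψ i * φ j - ψ j * φ i)) * h2
  have hdiff : ∀ i j, ‖swapTestState ψ φ 0 i j‖ ^ 2 - ‖swapTestState ψ φ 1 i j‖ ^ 2 =
      ((φ j * starRingEnd ℂ (ψ j)) * starRingEnd ℂ (φ i * starRingEnd ℂ (ψ i))).re := by
    intro i j
    rw [e0, e1, ← Complex.normSq_eq_norm_sq, ← Complex.normSq_eq_norm_sq]
    simp only [Complex.normSq_apply, Complex.div_re, Complex.div_im, Complex.add_re,
      Complex.add_im, Complex.sub_re, Complex.sub_im, Complex.mul_re, Complex.mul_im, map_mul,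
      Complex.conj_conj, Complex.conj_re, Complex.conj_im, Complex.re_ofNat, Complex.im_ofNat]
    ring
  have hinner : inner ℂ ψ φ = ∑ i, φ i * starRingEnd ℂ (ψ i) := by
    simp [PiLp.inner_apply]
  have hnorm : ((‖inner ℂ ψ φ‖ ^ 2 : ℝ) : ℂ) =
      inner ℂ ψ φ * starRingEnd ℂ (inner ℂ ψ φ) := by
    rw [Complex.mul_conj, Complex.normSq_eq_norm_sq]
  have hre : ‖inner ℂ ψ φ‖ ^ 2 = (inner ℂ ψ φ * starRingEnd ℂ (inner ℂ ψ φ)).re := by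
    rw [← hnorm, Complex.ofReal_re]
  rw [hre, hinner, map_sum, Finset.sum_mul_sum, Finset.sum_comm]
  simp only [Fin.sum_univ_two, ancillaProb, outcomeSign, Complex.re_sum, if_true, mul_one,
    one_ne_zero, if_false, mul_neg, ← sub_eq_add_neg, ← Finset.sum_sub_distrib, hdiff]

theorem sum_outcomeProb_mul_outcomeSign_pow (ℓ : Fin N × Fin N) :
    (∑ a, outcomeProb E F ℓ a * outcomeSign a) ^ k = labelFidelity k E F ℓ := by
  unfold outcomeProb labelFidelity
  rw [sum_ancillaProb_mul_outcomeSign, pow_mul]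

theorem avgFidelity_eq (hE : E.IsUniform) (hF : F.IsUniform) :
    avgFidelity k E F =
      (∑ ℓ, labelFidelity k E F ℓ) / Fintype.card (Fin N × Fin N) := by
  unfold avgFidelity
  rw [Fintype.sum_prod_type, Finset.sum_div]
  refine Finset.sum_congr rfl fun i _ => ?_
  rw [Finset.sum_div]
  refine Finset.sum_congr rfl fun j _ => ?_
  rw [hE i, hF j]
  simp [labelFidelity]
  ring

theorem toReal_sampleLaw (hE : E.IsUniform) (hF : F.IsUniform) (p : Sample N) :
    (sampleLaw E F p).toReal = ((N : ℝ) ^ 2)⁻¹ * outcomeProb E F p.1 p.2 := by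
  obtain ⟨⟨i, j⟩, a⟩ := p
  have hmap : ∀ i' j', ((swapTestLaw (E.state i') (F.state j') (E.norm_state i')
      (F.norm_state j')).map fun b => ((i', j'), b)) ((i, j), a) =
      if i = i' ∧ j = j' then ENNReal.ofReal (outcomeProb E F (i', j') a) else 0 := by
    intro i' j'
    rw [PMF.map_apply, tsum_fintype]
    by_cases h : i = i' ∧ j = j'
    · obtain ⟨rfl, rfl⟩ := h
      simp [swapTestLaw, outcomeProb]
    · rw [if_neg h]
      refine Finset.sum_eq_zero fun b _ => if_neg ?_
      intro e
      simp only [Prod.mk.injEq] at e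
      exact h e.1
  have : sampleLaw E F ((i, j), a) =
      (N : ENNReal)⁻¹ * ((N : ENNReal)⁻¹ * ENNReal.ofReal (outcomeProb E F (i, j) a)) := by
    rw [sampleLaw, PMF.bind_apply, tsum_fintype, Finset.sum_eq_single i, hE,
      PMF.bind_apply, tsum_fintype, Finset.sum_eq_single j, hF, hmap, if_pos ⟨rfl, rfl⟩]
    · intro j' _ h
      rw [hmap, if_neg fun e => h e.2.symm, mul_zero]
    · simp
    · intro i' _ h
      rw [PMF.bind_apply, tsum_fintype, Finset.sum_eq_zero, mul_zero]
      intro j' _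
      rw [hmap, if_neg fun e => h e.1.symm, mul_zero]
    · simp
  rw [this]
  simp only [ENNReal.toReal_mul, ENNReal.toReal_inv, ENNReal.toReal_natCast,
    ENNReal.toReal_ofReal ((outcomeProb_mem E F (i, j)).1 a)]
  ring

instance isProbabilityMeasure_dataLaw : MeasureTheory.IsProbabilityMeasure (dataLaw E F s) := by
  unfold dataLaw
  infer_instance

theorem dataLaw_real (hE : E.IsUniform) (hF : F.IsUniform) (A : Set (Fin s → Sample N)) :
    (dataLaw E F s).real A =
      piExp (fun _ p => ((N : ℝ) ^ 2)⁻¹ * outcomeProb E F p.1 p.2) (A.indicator 1) := by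
  classical
  have hA : A = ((Finset.univ.filter fun x => x ∈ A : Finset (Fin s → Sample N)) : Set _) := by
    ext; simp
  conv_lhs => rw [hA]
  rw [← MeasureTheory.sum_measureReal_singleton, Finset.sum_filter]
  unfold piExp
  refine Finset.sum_congr rfl fun x _ => ?_
  by_cases hx : x ∈ A
  · simp [hx, MeasureTheory.measureReal_def, dataLaw, ENNReal.toReal_prod,
      toReal_sampleLaw hE hF]
  · simp [hx]

/-- The labels are uniform, and given the labels the outcomes are independent. -/
theorem piExp_sample (w : ℝ) (q : Fin N × Fin N → Fin 2 → ℝ) (G : (Fin s → Sample N) → ℝ) :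
    piExp (fun _ p => w * q p.1 p.2) G = piExp (fun _ _ => w) fun lam =>
      piExp (fun t => q (lam t)) fun a => G fun t => (lam t, a t) := by
  unfold piExp
  rw [← (Equiv.arrowProdEquivProdArrow (Fin s) (fun _ => Fin N × Fin N)
    (fun _ => Fin 2)).symm.sum_comp, Fintype.sum_prod_type]
  refine Finset.sum_congr rfl fun lam _ => ?_
  rw [Finset.mul_sum]
  refine Finset.sum_congr rfl fun a _ => ?_
  simp only [Finset.prod_mul_distrib, mul_assoc]
  rfl

theorem uniform_mem_stdSimplex (hN : 0 < N) :
    (fun _ : Fin N × Fin N => ((N : ℝ) ^ 2)⁻¹) ∈ stdSimplex ℝ (Fin N × Fin N) := by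
  have : (N : ℝ) ≠ 0 := by exact_mod_cast hN.ne'
  refine ⟨fun _ => by positivity, ?_⟩
  simp
  field_simp

theorem frequentLabels_perm_comp (σ : Equiv.Perm (Fin N × Fin N))
    (lam : Fin s → Fin N × Fin N) :
    frequentLabels k (fun t => σ (lam t)) = (frequentLabels k lam).map σ.toEmbedding := by
  ext ℓ
  simp [frequentLabels, labelCount_perm_comp, Finset.mem_map_equiv]

/-! ### Exponential moment of the estimation error -/

/-- The number of labels that occur at least `k` times or the number of the other labels,
whichever is smaller. -/
noncomputable def minorityCount (k : ℕ) (lam : Fin s → Fin N × Fin N) : ℝ :=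
  min ((frequentLabels k lam).card : ℝ) ((N : ℝ) ^ 2 - (frequentLabels k lam).card)

/-- The error of the estimator has two sources: the outcomes of the SWAP tests given the labels,
and the random choice of the frequent labels among all labels. They contribute the two terms of
the exponent. -/
theorem piExp_mul_exp_error_le (hk : 1 ≤ k) (hE : E.IsUniform) (hF : F.IsUniform)
    {Ψ : (Fin s → Fin N × Fin N) → ℝ} (hΨ0 : ∀ lam, 0 ≤ Ψ lam)
    (hΨ : ∀ (σ : Equiv.Perm (Fin N × Fin N)) lam, Ψ (fun t => σ (lam t)) = Ψ lam) (τ : ℝ) :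
    piExp (fun _ p => ((N : ℝ) ^ 2)⁻¹ * outcomeProb E F p.1 p.2) (fun x : Fin s → Sample N =>
        Ψ (fun t => (x t).1) *
          Real.exp (τ * ∑ ℓ ∈ goodLabels k x, (uStat k x ℓ - avgFidelity k E F))) ≤
      piExp (fun _ _ => ((N : ℝ) ^ 2)⁻¹) fun lam => Ψ lam *
        Real.exp (2 * τ ^ 2 * k ^ 2 * ∑ ℓ ∈ frequentLabels k lam, 1 / (labelCount lam ℓ : ℝ) +
          τ ^ 2 / 2 * minorityCount k lam) := by
  have hN := E.pos
  have hu := uniform_mem_stdSimplex hN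
  have : Nonempty (Fin N × Fin N) := ⟨(⟨0, hN⟩, ⟨0, hN⟩)⟩
  set μ := avgFidelity k E F with hμ
  have hcard : (Fintype.card (Fin N × Fin N) : ℝ) = (N : ℝ) ^ 2 := by
    simp [sq]
  rw [piExp_sample]
  calc _ ≤ piExp (fun _ _ => ((N : ℝ) ^ 2)⁻¹) (fun lam => Ψ lam * Real.exp (2 * τ ^ 2 * k ^ 2 *
          ∑ ℓ ∈ frequentLabels k lam, 1 / (labelCount lam ℓ : ℝ) +
          τ * ∑ ℓ ∈ frequentLabels k lam, (labelFidelity k E F ℓ - μ))) := by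
        refine piExp_mono (fun _ => hu) fun lam => ?_
        have h1 : ∀ a : Fin s → Fin 2, Ψ (fun t => (((lam t, a t) : Sample N)).1) *
            Real.exp (τ * ∑ ℓ ∈ goodLabels k (fun t => (lam t, a t)),
              (uStat k (fun t => (lam t, a t)) ℓ - μ)) =
            (Ψ lam * Real.exp (-(τ * ∑ ℓ ∈ frequentLabels k lam, μ))) *
              Real.exp (τ * ∑ ℓ ∈ frequentLabels k lam, uStat k (fun t => (lam t, a t)) ℓ) := by
          intro a
          rw [goodLabels_eq, mul_assoc, ← Real.exp_add, Finset.sum_sub_distrib]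
          ring_nf
        simp only [h1]
        rw [piExp_const_mul, mul_assoc]
        refine mul_le_mul_of_nonneg_left ?_ (hΨ0 lam)
        refine (mul_le_mul_of_nonneg_left
          (piExp_exp_sum_uStat_le hk (outcomeProb_mem E F) lam τ) (Real.exp_pos _).le).trans_eq ?_
        rw [← Real.exp_add]
        simp only [sum_outcomeProb_mul_outcomeSign_pow, Finset.sum_sub_distrib]
        ring_nf
    _ ≤ _ := by
        rw [piExp_eq_piExp_average_perm]
        refine piExp_mono (fun _ => hu) fun lam => ?_
        have h2 : ∀ σ : Equiv.Perm (Fin N × Fin N),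
            Ψ (fun t => σ (lam t)) * Real.exp (2 * τ ^ 2 * k ^ 2 *
              ∑ ℓ ∈ frequentLabels k (fun t => σ (lam t)),
                1 / (labelCount (fun t => σ (lam t)) ℓ : ℝ) +
              τ * ∑ ℓ ∈ frequentLabels k (fun t => σ (lam t)), (labelFidelity k E F ℓ - μ)) =
            Ψ lam * Real.exp (2 * τ ^ 2 * k ^ 2 *
              ∑ ℓ ∈ frequentLabels k lam, 1 / (labelCount lam ℓ : ℝ)) *
              Real.exp (τ * ∑ ℓ ∈ frequentLabels k lam, (labelFidelity k E F (σ ℓ) - μ)) := by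
          intro σ
          rw [hΨ, frequentLabels_perm_comp, Finset.sum_map, Finset.sum_map,
            mul_assoc (Ψ lam), ← Real.exp_add]
          simp [labelCount_perm_comp]
        simp only [h2]
        rw [← Finset.mul_sum, mul_div_assoc, Real.exp_add, ← mul_assoc]
        refine mul_le_mul_of_nonneg_left ?_ (mul_nonneg (hΨ0 lam) (Real.exp_pos _).le)
        have := sum_perm_exp_le (a := labelFidelity k E F) labelFidelity_nonneg
          labelFidelity_le_one (frequentLabels k lam) τ
        rw [← avgFidelity_eq hE hF, hcard] at this
        exact this

/-- The event that the estimator from the data of one pair is undefined or off by more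
than `η`. -/
def estFails (k : ℕ) (E F : PureEnsemble d N) (η : ℝ) : Set (Fin s → Sample N) :=
  {x | ¬((goodLabels k x).Nonempty ∧ |avgFidelityEst k x - avgFidelity k E F| ≤ η)}

/-- A failure makes the sum of the errors of the U-statistics, or its negative, at least `η` times
the number of good labels; this includes the case without any good label, where both vanish. -/
theorem le_abs_sum_of_mem_estFails {η : ℝ} {x : Fin s → Sample N}
    (hx : x ∈ estFails k E F η) :
    η * (goodLabels k x).card ≤
      |∑ ℓ ∈ goodLabels k x, (uStat k x ℓ - avgFidelity k E F)| := by
  rcases (goodLabels k x).eq_empty_or_nonempty with h | h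
  · simp [h]
  · have hx' : η < |avgFidelityEst k x - avgFidelity k E F| := by
      by_contra hcon
      exact hx ⟨h, not_lt.1 hcon⟩
    have hG : (0 : ℝ) < (goodLabels k x).card := by exact_mod_cast h.card_pos
    have : ∑ ℓ ∈ goodLabels k x, (uStat k x ℓ - avgFidelity k E F) =
        (avgFidelityEst k x - avgFidelity k E F) * (goodLabels k x).card := by
      rw [Finset.sum_sub_distrib, Finset.sum_const, nsmul_eq_mul, avgFidelityEst]
      field_simp
    rw [this, abs_mul, abs_of_pos hG]
    gcongr

/-- The exponential Markov inequality for the failure of the estimator on an event `D` that is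
determined by the labels and invariant under relabeling. -/
theorem dataLaw_real_estFails_inter_le (hk : 1 ≤ k) (hE : E.IsUniform) (hF : F.IsUniform)
    {D : Set (Fin s → Fin N × Fin N)}
    (hD : ∀ (σ : Equiv.Perm (Fin N × Fin N)) lam, (fun t => σ (lam t)) ∈ D ↔ lam ∈ D)
    {τ : ℝ} (hτ : 0 ≤ τ) (η : ℝ) :
    (dataLaw E F s).real (estFails k E F η ∩ {x | (fun t => (x t).1) ∈ D}) ≤
      2 * piExp (fun _ _ => ((N : ℝ) ^ 2)⁻¹) (D.indicator fun lam =>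
        Real.exp (2 * τ ^ 2 * k ^ 2 * ∑ ℓ ∈ frequentLabels k lam, 1 / (labelCount lam ℓ : ℝ) +
          τ ^ 2 / 2 * minorityCount k lam - τ * η * (frequentLabels k lam).card)) := by
  have hN := E.pos
  have hu := uniform_mem_stdSimplex hN
  have hw : (fun p : Sample N => ((N : ℝ) ^ 2)⁻¹ * outcomeProb E F p.1 p.2) ∈
      stdSimplex ℝ (Sample N) := by
    refine ⟨fun p => mul_nonneg (hu.1 p.1) ((outcomeProb_mem E F p.1).1 _), ?_⟩
    rw [Fintype.sum_prod_type]
    simp only [← Finset.mul_sum, (outcomeProb_mem E F _).2, mul_one]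
    exact hu.2
  set Ψ : (Fin s → Fin N × Fin N) → ℝ := D.indicator fun lam =>
    Real.exp (-(τ * η * (frequentLabels k lam).card)) with hΨdef
  have hΨ0 : ∀ lam, 0 ≤ Ψ lam := fun lam =>
    Set.indicator_nonneg (fun _ _ => (Real.exp_pos _).le) _
  have hΨ : ∀ (σ : Equiv.Perm (Fin N × Fin N)) lam, Ψ (fun t => σ (lam t)) = Ψ lam := by
    intro σ lam
    by_cases h : lam ∈ D
    · rw [hΨdef, Set.indicator_of_mem h, Set.indicator_of_mem ((hD σ lam).2 h),
        frequentLabels_perm_comp, Finset.card_map]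
    · rw [hΨdef, Set.indicator_of_notMem h, Set.indicator_of_notMem fun h' => h ((hD σ lam).1 h')]
  rw [dataLaw_real hE hF, two_mul]
  have h1 := piExp_mul_exp_error_le hk hE hF hΨ0 hΨ τ
  have h2 := piExp_mul_exp_error_le hk hE hF hΨ0 hΨ (-τ)
  rw [neg_sq] at h2
  have hrhs : ∀ lam, Ψ lam *
        Real.exp (2 * τ ^ 2 * k ^ 2 * ∑ ℓ ∈ frequentLabels k lam, 1 / (labelCount lam ℓ : ℝ) +
          τ ^ 2 / 2 * minorityCount k lam) = D.indicator (fun lam =>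
        Real.exp (2 * τ ^ 2 * k ^ 2 * ∑ ℓ ∈ frequentLabels k lam, 1 / (labelCount lam ℓ : ℝ) +
          τ ^ 2 / 2 * minorityCount k lam - τ * η * (frequentLabels k lam).card)) lam := by
    intro lam
    by_cases h : lam ∈ D
    · rw [hΨdef, Set.indicator_of_mem h, Set.indicator_of_mem h, ← Real.exp_add]
      ring_nf
    · rw [hΨdef, Set.indicator_of_notMem h, Set.indicator_of_notMem h, zero_mul]
  simp only [hrhs] at h1 h2
  refine le_trans ?_ (add_le_add h1 h2)
  rw [← piExp_add]
  refine piExp_mono (fun _ => hw) fun x => ?_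
  by_cases hx : x ∈ estFails k E F η ∩ {x | (fun t => (x t).1) ∈ D}
  · have hxD : (fun t => (x t).1) ∈ D := hx.2
    rw [Set.indicator_of_mem hx, Pi.one_apply, hΨdef, Set.indicator_of_mem hxD, ← mul_add]
    have hle := mul_le_mul_of_nonneg_left (le_abs_sum_of_mem_estFails hx.1) hτ
    rw [goodLabels_eq] at hle
    rw [goodLabels_eq]
    set W := ∑ ℓ ∈ frequentLabels k (fun t => (x t).1), (uStat k x ℓ - avgFidelity k E F)
    have hexp : Real.exp (τ * |W|) ≤ Real.exp (τ * W) + Real.exp (-τ * W) := by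
      rcases abs_choice W with h | h <;> rw [h]
      · linarith [Real.exp_pos (-τ * W)]
      · rw [mul_neg, ← neg_mul]
        linarith [Real.exp_pos (τ * W)]
    calc (1 : ℝ) ≤ Real.exp (-(τ * η * (frequentLabels k fun t => (x t).1).card)) *
          Real.exp (τ * |W|) := by
          rw [← Real.exp_add]
          apply Real.one_le_exp
          linarith
      _ ≤ _ := mul_le_mul_of_nonneg_left hexp (Real.exp_pos _).le
  · rw [Set.indicator_of_notMem hx, ← mul_add]
    exact mul_nonneg (hΨ0 _) (add_pos (Real.exp_pos _) (Real.exp_pos _)).le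

end Data

/-! ### Failure probability for one pair -/

section Failure

variable {d N s k : ℕ} {E F : PureEnsemble d N} {η : ℝ}

theorem dataLaw_real_estFails_le (hk : 1 ≤ k) (hE : E.IsUniform) (hF : F.IsUniform) {τ : ℝ}
    (hτ : 0 ≤ τ) (η : ℝ) :
    (dataLaw E F s).real (estFails k E F η) ≤
      2 * piExp (fun _ _ => ((N : ℝ) ^ 2)⁻¹) (fun lam : Fin s → Fin N × Fin N =>
        Real.exp (2 * τ ^ 2 * k ^ 2 * ∑ ℓ ∈ frequentLabels k lam, 1 / (labelCount lam ℓ : ℝ) +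
          τ ^ 2 / 2 * minorityCount k lam - τ * η * (frequentLabels k lam).card)) := by
  have := dataLaw_real_estFails_inter_le (s := s) hk hE hF (D := Set.univ) (by simp) hτ η
  simpa using this

/-- The bound for few samples per label: the number of frequent labels may be small compared to
the number of labels, and the error is controlled by this number alone. -/
theorem estFails_le_of_sparse (hk : 1 ≤ k) (hE : E.IsUniform) (hF : F.IsUniform) (hη0 : 0 ≤ η)
    (hη1 : η ≤ 1) {b : ℕ} (hb : k * b ≤ s) :
    (dataLaw E F s).real (estFails k E F η) ≤
      2 * Real.exp (-(η ^ 2 / (24 * k) * ((N : ℝ) ^ 2 *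
        (1 - (1 - ((N : ℝ) ^ 2)⁻¹) ^ b) ^ k))) := by
  have hN := E.pos
  have hu := uniform_mem_stdSimplex hN
  have hk0 : (1 : ℝ) ≤ k := by exact_mod_cast hk
  set p := (1 - (1 - ((N : ℝ) ^ 2)⁻¹) ^ b) ^ k with hp
  set x := η ^ 2 / (12 * k) with hx
  have hx0 : 0 ≤ x := by positivity
  have hx1 : x ≤ 1 := by
    rw [hx, div_le_one (by positivity)]
    nlinarith
  -- This `τ` minimizes the exponent `- τ η + 3 k τ ^ 2` per frequent label.
  refine (dataLaw_real_estFails_le hk hE hF (τ := η / (6 * k)) (by positivity) η).trans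
    (mul_le_mul_of_nonneg_left ?_ zero_le_two)
  have hpoint : ∀ lam : Fin s → Fin N × Fin N,
      Real.exp (2 * (η / (6 * k)) ^ 2 * k ^ 2 *
          ∑ ℓ ∈ frequentLabels k lam, 1 / (labelCount lam ℓ : ℝ) +
        (η / (6 * k)) ^ 2 / 2 * minorityCount k lam -
          η / (6 * k) * η * (frequentLabels k lam).card) ≤
      ∏ ℓ, if k ≤ labelCount lam ℓ then Real.exp (-x) else 1 := by
    intro lam
    rw [← Finset.prod_filter, Finset.prod_const, ← Real.exp_nat_mul]
    change _ ≤ Real.exp ((frequentLabels k lam).card * -x)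
    apply Real.exp_le_exp.2
    set G : ℝ := ((frequentLabels k lam).card : ℝ) with hG
    have hG0 : 0 ≤ G := Nat.cast_nonneg _
    have h1 : ∑ ℓ ∈ frequentLabels k lam, 1 / (labelCount lam ℓ : ℝ) ≤ G / k := by
      calc _ ≤ ∑ ℓ ∈ frequentLabels k lam, 1 / (k : ℝ) := by
            refine Finset.sum_le_sum fun ℓ hℓ => ?_
            have : (k : ℝ) ≤ labelCount lam ℓ := by
              exact_mod_cast (Finset.mem_filter.1 hℓ).2
            gcongr
        _ = _ := by rw [Finset.sum_const, nsmul_eq_mul, hG]; ring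
    have h2 : minorityCount k lam ≤ G := min_le_left _ _
    calc _ ≤ 2 * (η / (6 * k)) ^ 2 * k ^ 2 * (G / k) + (η / (6 * k)) ^ 2 / 2 * G -
          η / (6 * k) * η * G := by gcongr
      _ = η ^ 2 * G / (6 * k) * (1 / 3 + 1 / (12 * k) - 1) := by
          field_simp
          ring
      _ ≤ η ^ 2 * G / (6 * k) * (-(1 / 2)) := by
          refine mul_le_mul_of_nonneg_left ?_ (by positivity)
          have : 1 / (12 * (k : ℝ)) ≤ 1 / 12 := by
            apply one_div_le_one_div_of_le <;> linarith
          linarith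
      _ = G * -x := by
          rw [hx]
          field_simp
          ring
  refine (piExp_mono (fun _ => hu) hpoint).trans ?_
  have hanti : Antitone fun m : ℕ => if k ≤ m then Real.exp (-x) else 1 := by
    intro m m' hm
    dsimp only
    split_ifs
    · exact le_rfl
    · exact Real.exp_le_one_iff.2 (by linarith)
    · omega
    · exact le_rfl
  refine (piExp_prod_labelCount_le (fun _ => hu) hanti
    (fun m => by split_ifs <;> positivity) Finset.univ).trans ?_
  have hfac : ∀ ℓ : Fin N × Fin N, piExp (fun (_ : Fin s) (_ : Fin N × Fin N) => ((N : ℝ) ^ 2)⁻¹)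
      (fun lam => if k ≤ labelCount lam ℓ then Real.exp (-x) else 1) ≤
        Real.exp (-(x / 2 * p)) := by
    intro ℓ
    have e : ∀ lam : Fin s → Fin N × Fin N,
        (if k ≤ labelCount lam ℓ then Real.exp (-x) else 1) =
          1 + (Real.exp (-x) - 1) * if k ≤ labelCount lam ℓ then 1 else 0 := by
      intro lam
      split_ifs <;> ring
    simp only [e]
    rw [piExp_add, piExp_const (fun _ => hu), piExp_const_mul]
    have hcount := pow_le_countTail hu ℓ hb
    have hp0 : 0 ≤ p := by
      have hi : ((N : ℝ) ^ 2)⁻¹ ≤ 1 := le_one_of_mem_stdSimplex hu ℓ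
      have hi0 : 0 ≤ ((N : ℝ) ^ 2)⁻¹ := hu.1 ℓ
      exact pow_nonneg (sub_nonneg.2 (pow_le_one₀ (by linarith) (by linarith))) _
    have hexp : Real.exp (-x) ≤ 1 - x / 2 := by
      have h1 : Real.exp (-x) ≤ 1 / (1 + x) := by
        rw [Real.exp_neg, ← one_div]
        exact one_div_le_one_div_of_le (by linarith) (by linarith [Real.add_one_le_exp x])
      refine h1.trans ?_
      rw [div_le_iff₀ (by linarith)]
      nlinarith
    calc 1 + (Real.exp (-x) - 1) * countTail (fun _ => ((N : ℝ) ^ 2)⁻¹) ℓ s k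
        ≤ 1 - x / 2 * p := by nlinarith
      _ ≤ _ := Real.one_sub_le_exp_neg _
  calc _ ≤ ∏ _ℓ : Fin N × Fin N, Real.exp (-(x / 2 * p)) :=
        Finset.prod_le_prod (fun ℓ _ => piExp_nonneg (fun _ => hu) fun lam => by
          split_ifs <;> positivity) fun ℓ _ => hfac ℓ
    _ = _ := by
        rw [Finset.prod_const, ← Real.exp_nat_mul]
        simp only [Finset.card_univ, Fintype.card_prod, Fintype.card_fin]
        push_cast
        rw [hx]
        congr 1
        field_simp
        ring

/-- The bound for many samples per label: a label is rare if it occurs less than `H` times, and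
the random choice of the frequent labels contributes to the error only through the rare ones. -/
theorem estFails_le_of_dense (hk : 1 ≤ k) (hE : E.IsUniform) (hF : F.IsUniform) (hη0 : 0 ≤ η)
    (hη1 : η ≤ 1) {H : ℕ} (hH : k ≤ H) :
    (dataLaw E F s).real (estFails k E F η) ≤
      2 * Real.exp (-(η ^ 2 * H * (N : ℝ) ^ 2 / (8 * k ^ 2)) + (N : ℝ) ^ 2 *
        (η ^ 2 * H ^ 2 * Real.exp (H ^ 2) * Real.exp (H - s / (2 * (N : ℝ) ^ 2)))) := by
  have hN := E.pos
  have hu := uniform_mem_stdSimplex hN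
  have hk0 : (1 : ℝ) ≤ k := by exact_mod_cast hk
  have hHk : (k : ℝ) ≤ H := by exact_mod_cast hH
  have hH0 : (1 : ℝ) ≤ H := hk0.trans hHk
  -- This `τ` minimizes the exponent `- τ η + 2 τ ^ 2 k ^ 2 / H` per frequent label.
  set τ := η * H / (4 * k ^ 2) with hτ
  have hτ0 : 0 ≤ τ := by positivity
  set u := η ^ 2 * H ^ 2 with hudef
  have hu0 : 0 ≤ u := by positivity
  have huH : u ≤ (H : ℝ) ^ 2 := by
    have : η ^ 2 ≤ 1 := pow_le_one₀ hη0 hη1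
    rw [hudef]
    nlinarith [sq_nonneg (H : ℝ)]
  have hτu : τ * η + 3 * k ^ 2 * τ ^ 2 ≤ u := by
    have e : τ * η + 3 * k ^ 2 * τ ^ 2 =
        η ^ 2 * (H * 4 + 3 * H ^ 2) / (16 * k ^ 2) := by
      rw [hτ]
      field_simp
      ring
    rw [e, div_le_iff₀ (by positivity), hudef, mul_assoc]
    refine mul_le_mul_of_nonneg_left ?_ (sq_nonneg η)
    have hk2 : (1 : ℝ) ≤ k ^ 2 := one_le_pow₀ hk0
    nlinarith [mul_le_mul_of_nonneg_left hk2 (sq_nonneg (H : ℝ))]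
  refine (dataLaw_real_estFails_le hk hE hF hτ0 η).trans
    (mul_le_mul_of_nonneg_left ?_ zero_le_two)
  have hpoint : ∀ lam : Fin s → Fin N × Fin N,
      Real.exp (2 * τ ^ 2 * k ^ 2 * ∑ ℓ ∈ frequentLabels k lam, 1 / (labelCount lam ℓ : ℝ) +
        τ ^ 2 / 2 * minorityCount k lam - τ * η * (frequentLabels k lam).card) ≤
      Real.exp (-(η ^ 2 * H * (N : ℝ) ^ 2 / (8 * k ^ 2))) *
        ∏ ℓ, if labelCount lam ℓ < H then Real.exp u else 1 := by
    intro lam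
    rw [← Finset.prod_filter, Finset.prod_const, ← Real.exp_nat_mul, ← Real.exp_add]
    apply Real.exp_le_exp.2
    set R := Finset.univ.filter fun ℓ => labelCount lam ℓ < H with hR
    set B : ℝ := (R.card : ℝ) with hB
    set G : ℝ := ((frequentLabels k lam).card : ℝ) with hG
    have hcover : (N : ℝ) ^ 2 ≤ G + B := by
      have h1 : (Finset.univ : Finset (Fin N × Fin N)) ⊆ frequentLabels k lam ∪ R := by
        intro ℓ _
        simp only [frequentLabels, hR, Finset.mem_union, Finset.mem_filter, Finset.mem_univ,
          true_and]
        omega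
      have h2 := (Finset.card_le_card h1).trans (Finset.card_union_le _ _)
      simp only [Finset.card_univ, Fintype.card_prod, Fintype.card_fin, ← sq] at h2
      rw [hG, hB]
      exact_mod_cast h2
    have hsum : ∑ ℓ ∈ frequentLabels k lam, 1 / (labelCount lam ℓ : ℝ) ≤
        B + (N : ℝ) ^ 2 / H := by
      calc _ ≤ ∑ ℓ ∈ frequentLabels k lam,
            ((if labelCount lam ℓ < H then (1 : ℝ) else 0) + 1 / H) := by
            refine Finset.sum_le_sum fun ℓ hℓ => ?_
            have hT : (k : ℝ) ≤ labelCount lam ℓ := by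
              exact_mod_cast (Finset.mem_filter.1 hℓ).2
            split_ifs with h
            · have : 1 / (labelCount lam ℓ : ℝ) ≤ 1 := by
                rw [div_le_one (by linarith)]
                linarith
              have : 0 ≤ 1 / (H : ℝ) := by positivity
              linarith
            · have : (H : ℝ) ≤ labelCount lam ℓ := by exact_mod_cast not_lt.1 h
              rw [zero_add]
              gcongr
        _ ≤ ∑ ℓ, ((if labelCount lam ℓ < H then (1 : ℝ) else 0) + 1 / H) :=
            Finset.sum_le_sum_of_subset_of_nonneg (Finset.subset_univ _) fun ℓ _ _ => by
              split_ifs <;> positivity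
        _ = _ := by
            rw [Finset.sum_add_distrib, Finset.sum_boole]
            simp only [Finset.sum_const, Finset.card_univ, Fintype.card_prod, Fintype.card_fin,
              nsmul_eq_mul, ← hR, ← hB]
            push_cast
            ring
    have hmin : minorityCount k lam ≤ B := (min_le_right _ _).trans (by linarith)
    have hB0 : 0 ≤ B := Nat.cast_nonneg _
    have hB2 : τ ^ 2 / 2 * B ≤ k ^ 2 * τ ^ 2 * B := by
      have : (1 : ℝ) ≤ k ^ 2 := one_le_pow₀ hk0
      nlinarith [mul_nonneg (sq_nonneg τ) hB0]
    calc _ ≤ 2 * τ ^ 2 * k ^ 2 * (B + (N : ℝ) ^ 2 / H) + τ ^ 2 / 2 * B -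
          τ * η * ((N : ℝ) ^ 2 - B) := by
          gcongr
          linarith
      _ ≤ (2 * τ ^ 2 * k ^ 2 / H - τ * η) * (N : ℝ) ^ 2 +
          B * (τ * η + 3 * k ^ 2 * τ ^ 2) := by
          have : 2 * τ ^ 2 * k ^ 2 * ((N : ℝ) ^ 2 / H) = 2 * τ ^ 2 * k ^ 2 / H * (N : ℝ) ^ 2 := by
            ring
          linarith
      _ ≤ (2 * τ ^ 2 * k ^ 2 / H - τ * η) * (N : ℝ) ^ 2 + B * u := by gcongr
      _ = _ := by
          rw [hτ]
          field_simp
          ring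
  refine (piExp_mono (fun _ => hu) hpoint).trans ?_
  rw [piExp_const_mul, Real.exp_add]
  refine mul_le_mul_of_nonneg_left ?_ (Real.exp_pos _).le
  have hanti : Antitone fun m : ℕ => if m < H then Real.exp u else 1 := by
    intro m m' hm
    dsimp only
    split_ifs
    · exact le_rfl
    · omega
    · exact Real.one_le_exp hu0
    · exact le_rfl
  refine (piExp_prod_labelCount_le (fun _ => hu) hanti
    (fun m => by split_ifs <;> positivity) Finset.univ).trans ?_
  set ρ := Real.exp (H - s / (2 * (N : ℝ) ^ 2)) with hρ
  have hfac : ∀ ℓ : Fin N × Fin N, piExp (fun (_ : Fin s) (_ : Fin N × Fin N) => ((N : ℝ) ^ 2)⁻¹)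
      (fun lam => if labelCount lam ℓ < H then Real.exp u else 1) ≤
        Real.exp (u * Real.exp (H ^ 2) * ρ) := by
    intro ℓ
    have e : ∀ lam : Fin s → Fin N × Fin N,
        (if labelCount lam ℓ < H then Real.exp u else 1) =
          1 + (Real.exp u - 1) * if labelCount lam ℓ < H then 1 else 0 := by
      intro lam
      split_ifs <;> ring
    simp only [e]
    rw [piExp_add, piExp_const (fun _ => hu), piExp_const_mul]
    have hρ' : (H : ℝ) - s * ((N : ℝ) ^ 2)⁻¹ / 2 = H - s / (2 * (N : ℝ) ^ 2) := by ring
    have htail := piExp_labelCount_lt_le hu ℓ s H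
    rw [hρ', ← hρ] at htail
    have hexp : Real.exp u - 1 ≤ u * Real.exp (H ^ 2) := by
      have h1 : Real.exp u - 1 ≤ u * Real.exp u := by
        have := Real.one_sub_le_exp_neg u
        have h2 : Real.exp (-u) * Real.exp u = 1 := by rw [← Real.exp_add]; simp
        nlinarith [Real.exp_pos u]
      refine h1.trans (mul_le_mul_of_nonneg_left (Real.exp_le_exp.2 huH) hu0)
    calc _ ≤ 1 + u * Real.exp (H ^ 2) * ρ := by
          have h0 : 0 ≤ Real.exp u - 1 := sub_nonneg.2 (Real.one_le_exp hu0)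
          have := mul_le_mul hexp htail
            (piExp_nonneg (fun _ => hu) fun lam => by split_ifs <;> norm_num)
            (h0.trans hexp)
          linarith
      _ ≤ _ := by linarith [Real.add_one_le_exp (u * Real.exp (H ^ 2) * ρ)]
  calc _ ≤ ∏ _ℓ : Fin N × Fin N, Real.exp (u * Real.exp (H ^ 2) * ρ) :=
        Finset.prod_le_prod (fun ℓ _ => piExp_nonneg (fun _ => hu) fun lam => by
          split_ifs <;> positivity) fun ℓ _ => hfac ℓ
    _ = _ := by
        rw [Finset.prod_const, ← Real.exp_nat_mul]
        simp only [Finset.card_univ, Fintype.card_prod, Fintype.card_fin]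
        push_cast
        rw [sq (N : ℝ)]

/-- The probability that the labels of the data have a given property. -/
theorem dataLaw_real_labels (hE : E.IsUniform) (hF : F.IsUniform)
    (D : Set (Fin s → Fin N × Fin N)) :
    (dataLaw E F s).real {x | (fun t => (x t).1) ∈ D} =
      piExp (fun _ _ => ((N : ℝ) ^ 2)⁻¹) (D.indicator 1) := by
  rw [dataLaw_real hE hF, piExp_sample]
  congr 1
  funext lam
  exact piExp_const (fun _ => outcomeProb_mem E F _) (D.indicator 1 lam)

/-- The bound when every label occurs at least `H` times with high probability: then the choice of
the frequent labels does not contribute to the error. -/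
theorem estFails_le_of_all_labels (hk : 1 ≤ k) (hE : E.IsUniform) (hF : F.IsUniform)
    (hη0 : 0 ≤ η) {H : ℕ} (hH : k ≤ H) :
    (dataLaw E F s).real (estFails k E F η) ≤
      2 * Real.exp (-(η ^ 2 * H * (N : ℝ) ^ 2 / (8 * k ^ 2))) +
        (N : ℝ) ^ 2 * Real.exp (H - s / (2 * (N : ℝ) ^ 2)) := by
  have hN := E.pos
  have hu := uniform_mem_stdSimplex hN
  have hk0 : (1 : ℝ) ≤ k := by exact_mod_cast hk
  have hH0 : (1 : ℝ) ≤ H := by exact_mod_cast hk.trans hH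
  set D : Set (Fin s → Fin N × Fin N) := {lam | ∀ ℓ, H ≤ labelCount lam ℓ} with hDdef
  have hD : ∀ (σ : Equiv.Perm (Fin N × Fin N)) (lam : Fin s → Fin N × Fin N),
      (fun t => σ (lam t)) ∈ D ↔ lam ∈ D := by
    intro σ lam
    simp only [hDdef, Set.mem_ofPred_eq, labelCount_perm_comp]
    exact σ.symm.forall_congr_left.trans (by simp)
  set τ := η * H / (4 * k ^ 2) with hτ
  have hτ0 : 0 ≤ τ := by positivity
  have hsplit : (dataLaw E F s).real (estFails k E F η) ≤
      (dataLaw E F s).real (estFails k E F η ∩ {x | (fun t => (x t).1) ∈ D}) +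
        (dataLaw E F s).real {x | (fun t => (x t).1) ∈ Dᶜ} := by
    refine (MeasureTheory.measureReal_mono ?_).trans (MeasureTheory.measureReal_union_le _ _)
    intro x hx
    by_cases h : (fun t => (x t).1) ∈ D
    · exact Or.inl ⟨hx, h⟩
    · exact Or.inr h
  refine hsplit.trans (add_le_add ?_ ?_)
  · refine (dataLaw_real_estFails_inter_le hk hE hF hD hτ0 η).trans
      (mul_le_mul_of_nonneg_left ?_ zero_le_two)
    refine le_trans (piExp_mono (fun _ => hu) fun lam => ?_)
      (piExp_const (fun _ : Fin s => hu) _).le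
    by_cases hlam : lam ∈ D
    · rw [Set.indicator_of_mem hlam]
      apply Real.exp_le_exp.2
      have hall : frequentLabels k lam = Finset.univ :=
        Finset.filter_true_of_mem fun ℓ _ => hH.trans (hlam ℓ)
      have hcard : ((Finset.univ : Finset (Fin N × Fin N)).card : ℝ) = (N : ℝ) ^ 2 := by
        simp [sq]
      have hmin : minorityCount k lam ≤ 0 := by
        refine (min_le_right _ _).trans ?_
        rw [hall, hcard, sub_self]
      have hsum : ∑ ℓ ∈ frequentLabels k lam, 1 / (labelCount lam ℓ : ℝ) ≤
          (N : ℝ) ^ 2 / H := by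
        calc _ ≤ ∑ ℓ ∈ frequentLabels k lam, 1 / (H : ℝ) := by
              refine Finset.sum_le_sum fun ℓ _ => ?_
              have : (H : ℝ) ≤ labelCount lam ℓ := by exact_mod_cast hlam ℓ
              gcongr
          _ = _ := by rw [hall, Finset.sum_const, nsmul_eq_mul, hcard]; ring
      rw [hall, hcard, ← hall]
      calc _ ≤ 2 * τ ^ 2 * k ^ 2 * ((N : ℝ) ^ 2 / H) + τ ^ 2 / 2 * 0 -
            τ * η * (N : ℝ) ^ 2 := by gcongr
        _ = _ := by
            rw [hτ]
            field_simp
            ring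
    · rw [Set.indicator_of_notMem hlam]
      exact (Real.exp_pos _).le
  · rw [dataLaw_real_labels hE hF]
    have hunion : ∀ lam : Fin s → Fin N × Fin N,
        Dᶜ.indicator (1 : (Fin s → Fin N × Fin N) → ℝ) lam ≤
          ∑ ℓ, if labelCount lam ℓ < H then (1 : ℝ) else 0 := by
      intro lam
      by_cases hlam : lam ∈ D
      · rw [Set.indicator_of_notMem (by simpa using hlam)]
        exact Finset.sum_nonneg fun ℓ _ => by split_ifs <;> norm_num
      · rw [Set.indicator_of_mem (by simpa using hlam)]
        simp only [hDdef, Set.mem_ofPred_eq, not_forall, not_le] at hlam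
        obtain ⟨ℓ, hℓ⟩ := hlam
        refine le_trans ?_ (Finset.single_le_sum (fun m _ => ?_) (Finset.mem_univ ℓ))
        · simp [hℓ]
        · split_ifs <;> norm_num
    refine (piExp_mono (fun _ => hu) hunion).trans ?_
    rw [piExp_sum]
    refine (Finset.sum_le_sum fun ℓ _ => piExp_labelCount_lt_le hu ℓ s H).trans (le_of_eq ?_)
    simp only [Finset.sum_const, Finset.card_univ, Fintype.card_prod, Fintype.card_fin,
      nsmul_eq_mul]
    push_cast
    ring_nf

end Failure

/-! ### Sample complexity -/

/-- The failure probabilities for the three pairs add up. -/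
theorem estimatesMMD_of_estFails_le {d N s k : ℕ} {E F : PureEnsemble d N} {ε δ : ℝ}
    (h₁ : (dataLaw E E s).real (estFails k E E (ε / 4)) ≤ δ / 3)
    (h₂ : (dataLaw F F s).real (estFails k F F (ε / 4)) ≤ δ / 3)
    (h₃ : (dataLaw E F s).real (estFails k E F (ε / 4)) ≤ δ / 3) :
    EstimatesMMD k E F s ε δ := by
  have hsub : {x : (Fin s → Sample N) × (Fin s → Sample N) × (Fin s → Sample N) |
      ¬(mmdEstDefined k x ∧ |mmdEst k x - mmd k E F| ≤ ε)} ⊆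
      (estFails k E E (ε / 4) ×ˢ (Set.univ ×ˢ Set.univ)) ∪
        ((Set.univ ×ˢ (estFails k F F (ε / 4) ×ˢ Set.univ)) ∪
          (Set.univ ×ˢ (Set.univ ×ˢ estFails k E F (ε / 4)))) := by
    rintro ⟨x, y, z⟩ hxyz
    by_contra hcon
    simp only [estFails, Set.mem_union, Set.mem_prod, Set.mem_univ, and_true, true_and,
      Set.mem_ofPred_eq, not_or, not_not] at hcon
    obtain ⟨⟨hx, hx'⟩, ⟨hy, hy'⟩, ⟨hz, hz'⟩⟩ := hcon
    refine hxyz ⟨⟨hx, hy, hz⟩, ?_⟩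
    simp only [mmdEst, mmd]
    rw [abs_le] at hx' hy' hz' ⊢
    constructor <;> linarith [hx'.1, hx'.2, hy'.1, hy'.2, hz'.1, hz'.2]
  unfold EstimatesMMD experimentLaw
  refine (MeasureTheory.measureReal_mono hsub).trans ?_
  refine (MeasureTheory.measureReal_union_le _ _).trans ?_
  refine (add_le_add_right (MeasureTheory.measureReal_union_le _ _) _).trans ?_
  simp only [MeasureTheory.measureReal_prod_prod, MeasureTheory.probReal_univ, mul_one, one_mul]
  linarith

/-- The factor by which an exponent has to exceed `log (1 / δ)` so that a tail event of this
exponent has probability at most `δ / 18`, for all `δ ≤ δ₀`. This leaves room for three tail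
events for each of the three pairs, with a factor `2` to spare. -/
noncomputable def tailFactor (δ₀ : ℝ) : ℝ := 1 + Real.log 18 / Real.log (1 / δ₀)

section Average

variable {d N s k : ℕ} {E F : PureEnsemble d N} {η : ℝ}

/-- With sufficiently many samples per label on average, the contribution of the rare labels is at
most half of the main term. -/
theorem estFails_le_of_le_average (hk : 1 ≤ k) (hE : E.IsUniform) (hF : F.IsUniform)
    (hη0 : 0 ≤ η) (hη1 : η ≤ 1) {H : ℕ} (hH : k ≤ H)
    (hs : 2 * (H + (H : ℝ) ^ 2 + 16 * k ^ 2 * H) * (N : ℝ) ^ 2 ≤ s) :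
    (dataLaw E F s).real (estFails k E F η) ≤
      2 * Real.exp (-(η ^ 2 * H * (N : ℝ) ^ 2 / (16 * k ^ 2))) := by
  have hk0 : (1 : ℝ) ≤ k := by exact_mod_cast hk
  have hH1 : (1 : ℝ) ≤ H := by exact_mod_cast hk.trans hH
  have hN0 : (0 : ℝ) < N := by exact_mod_cast E.pos
  refine (estFails_le_of_dense hk hE hF hη0 hη1 hH).trans
    (mul_le_mul_of_nonneg_left (Real.exp_le_exp.2 ?_) zero_le_two)
  have hL0 : (0 : ℝ) < (N : ℝ) ^ 2 := by positivity
  generalize (N : ℝ) ^ 2 = L at *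
  have hrare : Real.exp (H ^ 2) * Real.exp (H - s / (2 * L)) ≤ 1 / (16 * k ^ 2 * H) := by
    rw [← Real.exp_add]
    have hx : H + (H : ℝ) ^ 2 + 16 * k ^ 2 * H ≤ s / (2 * L) := by
      rw [le_div_iff₀ (by positivity)]
      linarith
    calc Real.exp (H ^ 2 + (H - s / (2 * L))) ≤ Real.exp (-(16 * k ^ 2 * H)) :=
          Real.exp_le_exp.2 (by linarith)
      _ ≤ _ := by
          rw [Real.exp_neg, ← one_div]
          exact one_div_le_one_div_of_le (by positivity)
            (by linarith [Real.add_one_le_exp (16 * (k : ℝ) ^ 2 * H)])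
  calc _ ≤ -(η ^ 2 * H * L / (8 * k ^ 2)) + L * (η ^ 2 * H ^ 2 * (1 / (16 * k ^ 2 * H))) := by
        rw [mul_assoc (η ^ 2 * (H : ℝ) ^ 2)]
        gcongr
    _ = _ := by
        field_simp
        ring

/-- With a bounded number of samples per label on average, the number of frequent labels is of
order `N ^ 2 * (s / N ^ 2) ^ k`. -/
theorem estFails_le_of_average_le (hk : 1 ≤ k) (hE : E.IsUniform) (hF : F.IsUniform)
    (hη0 : 0 ≤ η) (hη1 : η ≤ 1) {K : ℝ} (hK : 1 ≤ K) (hks : k ≤ s)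
    (hs : (s : ℝ) ≤ K * (N : ℝ) ^ 2) :
    (dataLaw E F s).real (estFails k E F η) ≤
      2 * Real.exp (-(η ^ 2 / (24 * k) * ((N : ℝ) ^ 2 *
        (s / (4 * k * K * (N : ℝ) ^ 2)) ^ k))) := by
  have hk0 : (1 : ℝ) ≤ k := by exact_mod_cast hk
  have hN0 : (0 : ℝ) < N := by exact_mod_cast E.pos
  -- Divide the samples into `k` batches of size `b`.
  set b := s / k with hb
  have hkb : k * b ≤ s := Nat.mul_div_le s k
  have hbs : (s : ℝ) ≤ 2 * k * b := by
    have h1b : 1 ≤ b := (Nat.le_div_iff_mul_le (by omega)).2 (by rwa [one_mul])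
    have h2b : s < b * k + k := Nat.lt_div_mul_add (by omega)
    have : s ≤ 2 * k * b := by nlinarith
    exact_mod_cast this
  have hbs' : (b : ℝ) ≤ s := by exact_mod_cast Nat.div_le_self s k
  clear_value b
  have hL1 : ((N : ℝ) ^ 2)⁻¹ ≤ 1 := le_one_of_mem_stdSimplex (uniform_mem_stdSimplex E.pos)
    (⟨0, E.pos⟩, ⟨0, E.pos⟩)
  have hL0 : (0 : ℝ) < (N : ℝ) ^ 2 := by positivity
  refine (estFails_le_of_sparse hk hE hF hη0 hη1 hkb).trans
    (mul_le_mul_of_nonneg_left (Real.exp_le_exp.2 (neg_le_neg ?_)) zero_le_two)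
  generalize (N : ℝ) ^ 2 = L at *
  -- A given label occurs in a batch with probability at least `s / (4 k K L)`.
  have hhit : s / (4 * k * K * L) ≤ 1 - (1 - L⁻¹) ^ b := by
    set y := (b : ℝ) / L with hy
    have hy0 : 0 ≤ y := by positivity
    have hyK : y ≤ K := by
      rw [hy, div_le_iff₀ hL0]
      linarith
    have hpow : (1 - L⁻¹) ^ b ≤ Real.exp (-y) := by
      calc (1 - L⁻¹) ^ b ≤ Real.exp (-L⁻¹) ^ b := by
            exact pow_le_pow_left₀ (by linarith) (Real.one_sub_le_exp_neg _) _
        _ = Real.exp (-y) := by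
            rw [← Real.exp_nat_mul, hy]
            ring_nf
    have hexp : Real.exp (-y) ≤ 1 / (1 + y) := by
      rw [Real.exp_neg, ← one_div]
      exact one_div_le_one_div_of_le (by linarith) (by linarith [Real.add_one_le_exp y])
    have hfrac : y / (2 * K) ≤ 1 - 1 / (1 + y) := by
      have : 1 - 1 / (1 + y) = y / (1 + y) := by
        field_simp
        ring
      rw [this]
      gcongr
      linarith
    have hsy : s / (4 * k * K * L) ≤ y / (2 * K) := by
      rw [hy, div_div, div_le_div_iff₀ (by positivity) (by positivity)]
      calc (s : ℝ) * (L * (2 * K)) ≤ 2 * k * b * (L * (2 * K)) := by gcongr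
        _ = b * (4 * k * K * L) := by ring
    linarith
  gcongr

end Average

section Complexity

variable {δ₀ δ : ℝ}

theorem one_le_tailFactor (h0 : 0 < δ₀) (h1 : δ₀ < 1) : 1 ≤ tailFactor δ₀ := by
  have : 0 < Real.log (1 / δ₀) := Real.log_pos (by rw [lt_div_iff₀ h0]; linarith)
  have : 0 ≤ Real.log 18 := Real.log_nonneg (by norm_num)
  unfold tailFactor
  have : 0 ≤ Real.log 18 / Real.log (1 / δ₀) := by positivity
  linarith

theorem log_one_div_le (hδ : 0 < δ) (hδ' : δ ≤ δ₀) : Real.log (1 / δ₀) ≤ Real.log (1 / δ) :=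
  Real.log_le_log (one_div_pos.2 (hδ.trans_le hδ')) (one_div_le_one_div_of_le hδ hδ')

theorem exp_neg_le_of_tailFactor_mul_le (h1 : δ₀ < 1) (hδ : 0 < δ) (hδ' : δ ≤ δ₀) {y : ℝ}
    (hy : tailFactor δ₀ * Real.log (1 / δ) ≤ y) : Real.exp (-y) ≤ δ / 18 := by
  have h0 : 0 < δ₀ := hδ.trans_le hδ'
  have ha : 0 < Real.log (1 / δ₀) := Real.log_pos (by rw [lt_div_iff₀ h0]; linarith)
  have hA := log_one_div_le hδ hδ'
  have h18 : 0 ≤ Real.log 18 := Real.log_nonneg (by norm_num)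
  have h2 : Real.log 18 ≤ Real.log 18 / Real.log (1 / δ₀) * Real.log (1 / δ) := by
    rw [div_mul_eq_mul_div, le_div_iff₀ ha]
    gcongr
  have h3 : Real.log (1 / δ) + Real.log 18 ≤ y := by
    unfold tailFactor at hy
    linarith
  calc Real.exp (-y) ≤ Real.exp (-(Real.log (1 / δ) + Real.log 18)) :=
        Real.exp_le_exp.2 (by linarith)
    _ = δ / 18 := by
        rw [neg_add, Real.exp_add, Real.exp_neg, Real.exp_neg, Real.exp_log (by positivity),
          Real.exp_log (by norm_num)]
        field_simp

/-- `3 * s` samples suffice for one pair if they are at least a constant times the bound for large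
ensembles. -/
theorem exists_estFails_le_of_largeEnsembleBound {k : ℕ} (hk : 1 ≤ k) (h0 : 0 < δ₀)
    (h1 : δ₀ < 1) : ∃ C : ℝ, 0 < C ∧ ∀ C' ≥ C, ∀ (d N : ℕ) (E F : PureEnsemble d N),
      E.IsUniform → F.IsUniform → ∀ ε δ : ℝ, 0 < ε → ε ≤ 2 → 0 < δ → δ ≤ δ₀ → ∀ s : ℕ,
      precisionCost k ε δ ≤ (N : ℝ) ^ 2 →
      C' * largeEnsembleBound k N ε δ ≤ ((3 * s : ℕ) : ℝ) →
        (dataLaw E F s).real (estFails k E F (ε / 4)) ≤ δ / 3 := by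
  have hk0 : (1 : ℝ) ≤ k := by exact_mod_cast hk
  set γ := tailFactor δ₀ with hγ
  have hγ1 : 1 ≤ γ := one_le_tailFactor h0 h1
  set a := Real.log (1 / δ₀) with ha
  have ha0 : 0 < a := Real.log_pos (by rw [lt_div_iff₀ h0]; linarith)
  -- The labels are considered rare below `H` occurrences, and `K` samples per label on average
  -- make rare labels sufficiently unlikely.
  obtain ⟨H, hHγ⟩ := exists_nat_ge (256 * (k : ℝ) ^ 2 * γ)
  have hk2 : (k : ℝ) ≤ k ^ 2 := by nlinarith
  have hHk : (k : ℝ) ≤ H := by nlinarith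
  have hH1 : (1 : ℝ) ≤ H := hk0.trans hHk
  set K : ℝ := 2 * (H + (H : ℝ) ^ 2 + 16 * k ^ 2 * H) with hK
  have hK1 : 1 ≤ K := by
    have : 0 ≤ 16 * (k : ℝ) ^ 2 * H := by positivity
    nlinarith
  refine ⟨max (4608 * k ^ 2 * K * γ) (12 * k / a), lt_max_of_lt_right (by positivity), ?_⟩
  intro C hC d N E F hE hF ε δ hε hε2 hδ hδ' s hPL hs
  have hC1 := (le_max_left _ _).trans hC
  have hC2 := (le_max_right _ _).trans hC
  have hN0 : (0 : ℝ) < N := by exact_mod_cast E.pos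
  set A := Real.log (1 / δ) with hA
  have haA : a ≤ A := log_one_div_le hδ hδ'
  have hA0 : 0 < A := ha0.trans_le haA
  set L : ℝ := (N : ℝ) ^ 2 with hL
  have hL0 : 0 < L := by positivity
  set P := precisionCost k ε δ with hP
  have hfac : (1 : ℝ) ≤ k.factorial := by exact_mod_cast Nat.succ_le_of_lt k.factorial_pos
  have hPA : A ≤ ε ^ 2 * P := by
    have : ε ^ 2 * P = k.factorial * A := by
      rw [hP, precisionCost, ← hA]
      field_simp
    rw [this]
    nlinarith
  have hP0 : 0 < P := by
    by_contra h
    nlinarith [sq_nonneg ε, not_lt.1 h]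
  have hεL : A ≤ ε ^ 2 * L := hPA.trans (by gcongr)
  have hC0 : 0 < C := lt_of_lt_of_le (by positivity) hC2
  -- The bound is `L z` with `z ^ k = P / L`.
  obtain ⟨z, hz0, hz1, hzk, hzB⟩ : ∃ z : ℝ, 0 < z ∧ z ≤ 1 ∧ z ^ k = P / L ∧
      largeEnsembleBound k N ε δ = L * z := by
    refine ⟨(P / L) ^ (1 / (k : ℝ)), by positivity, ?_, ?_, ?_⟩
    · exact Real.rpow_le_one (by positivity) ((div_le_one hL0).2 hPL) (by positivity)
    · rw [one_div]
      exact Real.rpow_inv_natCast_pow (by positivity) (by omega)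
    · have hLk : L ^ (1 / (k : ℝ)) = (N : ℝ) ^ (2 / (k : ℝ)) := by
        rw [hL, ← Real.rpow_natCast, ← Real.rpow_mul hN0.le]
        congr 1
        push_cast
        ring
      rw [largeEnsembleBound, ← hP, Real.div_rpow hP0.le hL0.le, hLk, Real.rpow_sub hN0, hL,
        Real.rpow_two]
      ring
  rw [hzB] at hs
  push_cast at hs
  by_cases hdense : K * L ≤ s
  · have hfail := estFails_le_of_le_average (η := ε / 4) hk hE hF (by positivity)
      (by linarith) (by exact_mod_cast hHk : k ≤ H) hdense
    have htail : Real.exp (-((ε / 4) ^ 2 * H * L / (16 * k ^ 2))) ≤ δ / 18 := by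
      apply exp_neg_le_of_tailFactor_mul_le h1 hδ hδ'
      rw [← hγ, ← hA, le_div_iff₀ (by positivity)]
      have : 256 * k ^ 2 * γ * A ≤ H * (ε ^ 2 * L) := by gcongr
      linarith
    linarith
  · have hsK : (s : ℝ) < K * L := not_le.1 hdense
    have hks : (k : ℝ) ≤ s := by
      have hzz : z ^ k ≤ z := pow_le_of_le_one hz0.le hz1 (by omega)
      have hPz : P ≤ L * z := by
        calc P = L * z ^ k := by rw [hzk]; field_simp
          _ ≤ L * z := by gcongr
      have hε4 : ε ^ 2 ≤ 4 := by linarith [pow_le_pow_left₀ hε.le hε2 2]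
      have hP4 : a / 4 ≤ P := by linarith [mul_le_mul_of_nonneg_right hε4 hP0.le]
      have : 12 * k / a * (a / 4) ≤ C * (L * z) := by
        refine mul_le_mul hC2 (hP4.trans hPz) (by positivity) hC0.le
      have e : 12 * k / a * (a / 4) = 3 * k := by
        field_simp
        ring
      linarith
    have hfail := estFails_le_of_average_le (η := ε / 4) hk hE hF (by positivity)
      (by linarith) hK1 (by exact_mod_cast hks) hsK.le
    suffices h : Real.exp (-((ε / 4) ^ 2 / (24 * k) * (L * (s / (4 * k * K * L)) ^ k))) ≤
        δ / 18 by linarith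
    apply exp_neg_le_of_tailFactor_mul_le h1 hδ hδ'
    rw [← hγ, ← hA]
    set c := C / (12 * k * K) with hc
    have hc1 : 384 * k * γ ≤ c := by
      rw [hc, le_div_iff₀ (by positivity)]
      calc 384 * k * γ * (12 * k * K) = 4608 * k ^ 2 * K * γ := by ring
        _ ≤ C := hC1
    have hc1' : 1 ≤ c := by linarith [one_le_mul_of_one_le_of_one_le hk0 hγ1]
    have hcz : c * z ≤ s / (4 * k * K * L) := by
      rw [hc, div_mul_eq_mul_div, div_le_div_iff₀ (by positivity) (by positivity)]
      calc C * z * (4 * k * K * L) = C * (L * z) * (4 * k * K) := by ring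
        _ ≤ 3 * s * (4 * k * K) := by gcongr
        _ = s * (12 * k * K) := by ring
    have hpowk : c * (P / L) ≤ (s / (4 * k * K * L)) ^ k := by
      calc c * (P / L) ≤ c ^ k * (P / L) := by
            gcongr
            exact le_self_pow₀ hc1' (by omega)
        _ = (c * z) ^ k := by rw [mul_pow, hzk]
        _ ≤ _ := by
            have : 0 ≤ c * z := by positivity
            gcongr
    calc γ * A ≤ γ * (ε ^ 2 * P) := by gcongr
      _ = (ε / 4) ^ 2 / (24 * k) * (L * (384 * k * γ * (P / L))) := by
          field_simp
          ring
      _ ≤ (ε / 4) ^ 2 / (24 * k) * (L * (c * (P / L))) := by gcongr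
      _ ≤ _ := by gcongr

/-- `3 * s` samples suffice for one pair if they are at least a constant times the bound under
which all labels are frequent. -/
theorem exists_estFails_le_of_allLabelsBound {k : ℕ} (hk : 1 ≤ k) (h0 : 0 < δ₀)
    (h1 : δ₀ < 1) : ∃ C : ℝ, 0 < C ∧ ∀ C' ≥ C, ∀ (d N : ℕ) (E F : PureEnsemble d N),
      E.IsUniform → F.IsUniform → ∀ ε δ : ℝ, 0 < ε → 0 < δ → δ ≤ δ₀ → ∀ s : ℕ,
      C' * allLabelsBound k N ε δ ≤ ((3 * s : ℕ) : ℝ) →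
        (dataLaw E F s).real (estFails k E F (ε / 4)) ≤ δ / 3 := by
  have hk0 : (1 : ℝ) ≤ k := by exact_mod_cast hk
  set γ := tailFactor δ₀ with hγ
  have hγ1 : 1 ≤ γ := one_le_tailFactor h0 h1
  refine ⟨3072 * k * γ, by positivity, ?_⟩
  intro C hC d N E F hE hF ε δ hε hδ hδ' s hs
  have hN1 : (1 : ℝ) ≤ N := by exact_mod_cast E.pos
  set A := Real.log (1 / δ) with hA
  have hA0 : 0 < A := Real.log_pos (by rw [lt_div_iff₀ hδ]; linarith)
  set L : ℝ := (N : ℝ) ^ 2 with hL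
  have hL1 : 1 ≤ L := one_le_pow₀ hN1
  have hL0 : 0 < L := by linarith
  have hC12 : 12 * γ ≤ C := by nlinarith
  have hC0 : 0 < C := by linarith
  have hlog : Real.log (L / δ) = Real.log L + A := by
    rw [Real.log_div hL0.ne' hδ.ne', hA, one_div, Real.log_inv]
    ring
  have hlogL : 0 ≤ Real.log L := Real.log_nonneg hL1
  push_cast at hs
  have hs1 : C * (k / ε ^ 2 * A) ≤ 3 * s :=
    (mul_le_mul_of_nonneg_left (le_max_left _ _) hC0.le).trans hs
  have hs2 : C * (L * (Real.log L + A + k)) ≤ 3 * s := by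
    rw [← hlog]
    exact (mul_le_mul_of_nonneg_left (le_max_right _ _) hC0.le).trans hs
  -- A quarter of the average number of samples per label.
  set y := (s : ℝ) / (4 * L) with hy
  have hy2 : γ * (Real.log L + A + k) ≤ y := by
    rw [hy, le_div_iff₀ (by positivity)]
    have : 12 * γ * (L * (Real.log L + A + k)) ≤ C * (L * (Real.log L + A + k)) := by
      gcongr
    linarith
  have hyk : (k : ℝ) ≤ y := by nlinarith
  set H := ⌊y⌋₊ with hH
  have hHk : k ≤ H := Nat.le_floor hyk
  have hHy : (H : ℝ) ≤ y := Nat.floor_le (by linarith)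
  have hHy2 : y ≤ 2 * H := by
    have h3 := Nat.lt_floor_add_one y
    rw [← hH] at h3
    have h4 : (1 : ℝ) ≤ H := by exact_mod_cast hk.trans hHk
    linarith
  refine (estFails_le_of_all_labels hk hE hF (by positivity) hHk).trans ?_
  rw [← hL]
  have hfirst : Real.exp (-((ε / 4) ^ 2 * H * L / (8 * k ^ 2))) ≤ δ / 18 := by
    apply exp_neg_le_of_tailFactor_mul_le h1 hδ hδ'
    rw [← hγ, ← hA]
    have hyL : y * L = s / 4 := by
      rw [hy]
      field_simp
    have h5 : C * (k * A) ≤ 3 * s * ε ^ 2 := by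
      have := mul_le_mul_of_nonneg_right hs1 (sq_nonneg ε)
      have e : C * (k / ε ^ 2 * A) * ε ^ 2 = C * (k * A) := by field_simp
      linarith
    calc γ * A = 3072 * k * γ * (k * A) / (3072 * k ^ 2) := by
          field_simp
      _ ≤ C * (k * A) / (3072 * k ^ 2) := by gcongr
      _ ≤ 3 * s * ε ^ 2 / (3072 * k ^ 2) := by gcongr
      _ = ε ^ 2 * (y * L) / (256 * k ^ 2) := by
          rw [hyL]
          field_simp
          ring
      _ ≤ ε ^ 2 * (2 * H * L) / (256 * k ^ 2) := by gcongr
      _ = _ := by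
          field_simp
          ring
  have hsecond : L * Real.exp (H - s / (2 * L)) ≤ δ / 18 := by
    have e : (s : ℝ) / (2 * L) = 2 * y := by
      rw [hy]
      field_simp
      ring
    rw [e]
    nth_rewrite 1 [← Real.exp_log hL0]
    rw [← Real.exp_add]
    refine le_trans (Real.exp_le_exp.2 ?_) (exp_neg_le_of_tailFactor_mul_le h1 hδ hδ'
      (y := γ * A) (by rw [← hγ]))
    nlinarith
  linarith

end Complexity

theorem mainTheorem2 (k : ℕ) (hk : 1 ≤ k) (δ₀ : ℝ) (hδ₀ : δ₀ < 1) :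
    ∃ C : ℝ, 0 < C ∧
      ∀ (d N : ℕ) (E₁ E₂ : PureEnsemble d N), E₁.IsUniform → E₂.IsUniform →
      ∀ ε δ : ℝ, 0 < ε → ε ≤ 2 → 0 < δ → δ ≤ δ₀ →
      ∀ s : ℕ,
        (precisionCost k ε δ ≤ (N : ℝ) ^ 2 →
          C * largeEnsembleBound k N ε δ ≤ ((3 * s : ℕ) : ℝ) →
            EstimatesMMD k E₁ E₂ s ε δ) ∧
        (precisionCost k ε δ ≤ (N : ℝ) ^ 2 →
          C * min (largeEnsembleBound k N ε δ) (allLabelsBound k N ε δ) ≤ ((3 * s : ℕ) : ℝ) →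
            EstimatesMMD k E₁ E₂ s ε δ) ∧
        (C * allLabelsBound k N ε δ ≤ ((3 * s : ℕ) : ℝ) →
            EstimatesMMD k E₁ E₂ s ε δ) := by
  -- If `δ₀ ≤ 0`, there is no admissible `δ`.
  rcases le_or_gt δ₀ 0 with h0 | h0
  · exact ⟨1, one_pos, fun d N E₁ E₂ _ _ ε δ _ _ hδ hδ' => absurd hδ (by linarith)⟩
  obtain ⟨C₁, hC₁, hlarge⟩ := exists_estFails_le_of_largeEnsembleBound hk h0 hδ₀
  obtain ⟨C₂, hC₂, hall⟩ := exists_estFails_le_of_allLabelsBound hk h0 hδ₀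
  refine ⟨max C₁ C₂, lt_max_of_lt_left hC₁, ?_⟩
  intro d N E₁ E₂ hE₁ hE₂ ε δ hε hε2 hδ hδ' s
  have part₁ : precisionCost k ε δ ≤ (N : ℝ) ^ 2 →
      max C₁ C₂ * largeEnsembleBound k N ε δ ≤ ((3 * s : ℕ) : ℝ) →
        EstimatesMMD k E₁ E₂ s ε δ := fun hP hs =>
    have h := fun (E F : PureEnsemble d N) hE hF =>
      hlarge _ (le_max_left _ _) d N E F hE hF ε δ hε hε2 hδ hδ' s hP hs
    estimatesMMD_of_estFails_le (h _ _ hE₁ hE₁) (h _ _ hE₂ hE₂) (h _ _ hE₁ hE₂)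
  have part₃ : max C₁ C₂ * allLabelsBound k N ε δ ≤ ((3 * s : ℕ) : ℝ) →
      EstimatesMMD k E₁ E₂ s ε δ := fun hs =>
    have h := fun (E F : PureEnsemble d N) hE hF =>
      hall _ (le_max_right _ _) d N E F hE hF ε δ hε hδ hδ' s hs
    estimatesMMD_of_estFails_le (h _ _ hE₁ hE₁) (h _ _ hE₂ hE₂) (h _ _ hE₁ hE₂)
  refine ⟨part₁, fun hP hs => ?_, part₃⟩
  rcases min_choice (largeEnsembleBound k N ε δ) (allLabelsBound k N ε δ) with h | h
  · exact part₁ hP (h ▸ hs)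
  · exact part₃ (h ▸ hs)
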